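/- Let $0<\gamma<6/5$ and $\tau_0\in\mathbb R$. Let $\Sigma_+,\bar N,\Omega,v_1$ be real-valued and $\Sigma_\times,\Sigma_1,N_\times,\mathbf v=v_2+iv_3$ complex-valued differentiable functions of $\tau\in[\tau_0,\infty)$ (the expansion-normalised shear, curvature, energy density and tilt-velocity variables of a tilted Bianchi type VII$_0$ model with a $\gamma$-law perfect fluid, in the gauge $\phi'=0$, with $\tau$ the dimensionless time defined by $dt/d\tau=1/H$). Put $$V=\sqrt{v_1^2+|\mathbf v|^2},\quad \Sigma^2=\Sigma_+^2+|\Sigma_\times|^2+|\Sigma_1|^2,\quad G_+=1+(\gamma-1)V^2,$$ $$V^2\mathcal S=\Sigma_{ab}v^av^b=\Sigma_+(-2v_1^2+|\mathbf v|^2)+\sqrt3\,\mathrm{Re}(\Sigma_\times(\mathbf v^*)^2)+2\sqrt3\,v_1\mathrm{Re}(\Sigma_1\mathbf v^*),$$ $$q=2\Sigma^2+\frac12\,\frac{(3\gamma-2)+(2-\gamma)V^2}{G_+}\,\Omega,\quad T=\frac{(3\gamma-4)(1-V^2)+(2-\gamma)V^2\mathcal S}{1-(\gamma-1)V^2}.$$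 Suppose that for all $\tau\ge\tau_0$ the evolution equations \begin{align*} \Sigma_+'&=(q-2)\Sigma_++3|\Sigma_1|^2-2|N_\times|^2+\tfrac{\gamma\Omega}{2G_+}(-2v_1^2+|\mathbf v|^2),\\ \Sigma_\times'&=(q-2)\Sigma_\times+\sqrt3\,\Sigma_1^2-2\sqrt3\,N_\times\bar N+\tfrac{\sqrt3\gamma\Omega}{2G_+}\mathbf v^2,\\ \Sigma_1'&=(q-2-3\Sigma_+)\Sigma_1-\sqrt3\,\Sigma_\times\Sigma_1^*+\tfrac{\sqrt3\gamma\Omega v_1}{G_+}\mathbf v,\\ N_\times'&=(q+2\Sigma_+)N_\times+2\sqrt3\,\Sigma_\times\bar N,\\ \bar N'&=(q+2\Sigma_+)\bar N+2\sqrt3\,\mathrm{Re}(\Sigma_\times^*N_\times),\\ \Omega'&=\tfrac{\Omega}{G_+}\{2q-(3\gamma-2)+[2q(\gamma-1)-(2-\gamma)-\gamma\mathcal S]V^2\},\\ v_1'&=(T+2\Sigma_+)v_1-2\sqrt3\,\mathrm{Re}(\Sigma_1\mathbf v^*)+\sqrt3\,\mathrm{Im}(N_\times^*\mathbf v^2),\\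 \mathbf v'&=(T-\Sigma_+-i\sqrt3\,\bar Nv_1)\mathbf v-\sqrt3\,(\Sigma_\times+iN_\times v_1)\mathbf v^* \end{align*} and the constraints $$1=\Sigma^2+|N_\times|^2+\Omega,\quad 0=2\,\mathrm{Im}(\Sigma_\times^*N_\times)+\frac{\gamma\Omega v_1}{G_+},\quad 0=i\Sigma_1\bar N+i\Sigma_1^*N_\times+\frac{\gamma\Omega\mathbf v}{G_+}$$ hold, and that at $\tau=\tau_0$ one has $\bar N^2-|N_\times|^2>0$ (type VII$_0$), $\Omega>0$ and $V<1$. Then the model is asymptotically non-tilted at late times: $\lim_{\tau\to\infty}V(\tau)=0$. -/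

import Mathlib

open scoped Matrix

noncomputable section

namespace BianchiVII0

/-- The expansion-normalised variables of a tilted Bianchi type VII₀ perfect fluid model at one
instant: shear `(Σ₊, Σ_×, Σ₁)`, curvature `(N_×, N̄)` (with `A = 0`), energy density `Ω`, and tilt
velocity `(v₁, 𝐯)` with `𝐯 = v₂ + i v₃`. -/
structure State where
  Sp : ℝ
  Sx : ℂ
  S1 : ℂ
  Nx : ℂ
  Nbar : ℝ
  Om : ℝ
  v1 : ℝ
  v : ℂ

namespace State

/-- The tilt speed `V`, where `V² = v₁² + |𝐯|²`. -/
def V (X : State) : ℝ := Real.sqrt (X.v1 ^ 2 + ‖X.v‖ ^ 2)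

/-- `Σ² = Σ₊² + |Σ_×|² + |Σ₁|²`. -/
def shearSq (X : State) : ℝ := X.Sp ^ 2 + ‖X.Sx‖ ^ 2 + ‖X.S1‖ ^ 2

/-- The symmetric trace-free shear tensor `Σ_ab`, in terms of
`Σ_× = Σ₋ + i Σ₂₃` and `Σ₁ = Σ₁₂ + i Σ₁₃`; its normalisation is `Σ² = Σ_ab Σ^ab / 6`. -/
def shear (X : State) : Matrix (Fin 3) (Fin 3) ℝ :=
  !![-2 * X.Sp, √3 * X.S1.re, √3 * X.S1.im;
     √3 * X.S1.re, X.Sp + √3 * X.Sx.re, √3 * X.Sx.im;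
     √3 * X.S1.im, √3 * X.Sx.im, X.Sp - √3 * X.Sx.re]

/-- The tilt direction `c^a`, where `v^a = V c^a`. It is the zero vector if `V = 0`; below it is
only used through `V² 𝒮`, so this convention plays no role. -/
def dir (X : State) : Fin 3 → ℝ := ![X.v1 / X.V, X.v.re / X.V, X.v.im / X.V]

/-- `𝒮 = Σ_ab c^a c^b`. -/
def calS (X : State) : ℝ := X.dir ⬝ᵥ (X.shear *ᵥ X.dir)

/-- `G₊ = 1 + (γ - 1) V²`. -/
def Gp (γ : ℝ) (X : State) : ℝ := 1 + (γ - 1) * X.V ^ 2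

/-- The deceleration parameter `q`. -/
def q (γ : ℝ) (X : State) : ℝ :=
  2 * X.shearSq + 1 / 2 * (((3 * γ - 2) + (2 - γ) * X.V ^ 2) / (1 + (γ - 1) * X.V ^ 2)) * X.Om

/-- The quantity `T` of the tilt evolution equations. -/
def T (γ : ℝ) (X : State) : ℝ :=
  ((3 * γ - 4) * (1 - X.V ^ 2) + (2 - γ) * X.V ^ 2 * X.calS) / (1 - (γ - 1) * X.V ^ 2)

/-- The constraint equations: the generalised Friedmann equation and the two momentum
constraints. -/
structure Constraints (γ : ℝ) (X : State) : Prop where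
  friedmann : 1 = X.shearSq + ‖X.Nx‖ ^ 2 + X.Om
  momentum_one : 0 = 2 * (star X.Sx * X.Nx).im + γ * X.Om * X.v1 / X.Gp γ
  momentum_two :
    0 = Complex.I * X.S1 * X.Nbar + Complex.I * star X.S1 * X.Nx
      + ((γ * X.Om / X.Gp γ : ℝ) : ℂ) * X.v

end State

/-- `X` is a future evolution, for `τ ∈ [τ₀, ∞)`, of the field equations of the tilted Bianchi
VII₀ models with equation of state parameter `γ`, in the gauge `φ' = 0` and in the dimensionless
time `τ`: it satisfies the evolution equations (`X.V` then automatically obeys the evolution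
equation of the tilt speed) and the constraints. At `τ₀` derivatives are one-sided. -/
structure IsEvolution (γ τ₀ : ℝ) (X : ℝ → State) : Prop where
  constraints : ∀ τ ≥ τ₀, (X τ).Constraints γ
  deriv_Sp : ∀ τ ≥ τ₀, HasDerivWithinAt (fun s => (X s).Sp)
    (((X τ).q γ - 2) * (X τ).Sp + 3 * ‖(X τ).S1‖ ^ 2 - 2 * ‖(X τ).Nx‖ ^ 2
      + γ * (X τ).Om / (2 * (X τ).Gp γ) * (-2 * (X τ).v1 ^ 2 + ‖(X τ).v‖ ^ 2)) (Set.Ici τ₀) τ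
  deriv_Sx : ∀ τ ≥ τ₀, HasDerivWithinAt (fun s => (X s).Sx)
    ((((X τ).q γ - 2 : ℝ) : ℂ) * (X τ).Sx + (√3 : ℝ) * (X τ).S1 ^ 2
      - 2 * (√3 : ℝ) * (X τ).Nx * (X τ).Nbar
      + ((√3 * γ * (X τ).Om / (2 * (X τ).Gp γ) : ℝ) : ℂ) * (X τ).v ^ 2) (Set.Ici τ₀) τ
  deriv_S1 : ∀ τ ≥ τ₀, HasDerivWithinAt (fun s => (X s).S1)
    ((((X τ).q γ - 2 - 3 * (X τ).Sp : ℝ) : ℂ) * (X τ).S1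
      - (√3 : ℝ) * (X τ).Sx * star (X τ).S1
      + ((√3 * γ * (X τ).Om * (X τ).v1 / (X τ).Gp γ : ℝ) : ℂ) * (X τ).v) (Set.Ici τ₀) τ
  deriv_Nx : ∀ τ ≥ τ₀, HasDerivWithinAt (fun s => (X s).Nx)
    ((((X τ).q γ + 2 * (X τ).Sp : ℝ) : ℂ) * (X τ).Nx
      + 2 * (√3 : ℝ) * (X τ).Sx * (X τ).Nbar) (Set.Ici τ₀) τ
  deriv_Nbar : ∀ τ ≥ τ₀, HasDerivWithinAt (fun s => (X s).Nbar)
    (((X τ).q γ + 2 * (X τ).Sp) * (X τ).Nbar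
      + 2 * √3 * (star (X τ).Sx * (X τ).Nx).re) (Set.Ici τ₀) τ
  deriv_Om : ∀ τ ≥ τ₀, HasDerivWithinAt (fun s => (X s).Om)
    ((X τ).Om / (X τ).Gp γ * (2 * (X τ).q γ - (3 * γ - 2)
      + (2 * (X τ).q γ * (γ - 1) - (2 - γ) - γ * (X τ).calS) * (X τ).V ^ 2)) (Set.Ici τ₀) τ
  deriv_v1 : ∀ τ ≥ τ₀, HasDerivWithinAt (fun s => (X s).v1)
    (((X τ).T γ + 2 * (X τ).Sp) * (X τ).v1 - 2 * √3 * ((X τ).S1 * star (X τ).v).re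
      + √3 * (star (X τ).Nx * (X τ).v ^ 2).im) (Set.Ici τ₀) τ
  deriv_v : ∀ τ ≥ τ₀, HasDerivWithinAt (fun s => (X s).v)
    ((((X τ).T γ - (X τ).Sp : ℝ) - Complex.I * (√3 : ℝ) * (X τ).Nbar * (X τ).v1) * (X τ).v
      - (√3 : ℝ) * ((X τ).Sx + Complex.I * (X τ).Nx * (X τ).v1) * star (X τ).v) (Set.Ici τ₀) τ

end BianchiVII0

end

/-! Two functions carry the argument. `logDensity`, the logarithm of a comoving density, has
derivative 2q - (3γ - 2) and is bounded above; so inside an exponential weight, q can be traded for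
a constant rate with a one-sided error. `tiltEnergy` dominates V², and its derivative is a positive
multiple of (3γ - 4)V² - V²𝒮; it suffices that it tends to 0. Subluminal tilt, Ω > 0 and a positive
curvature determinant persist because each quantity involved solves a linear equation f' = kf.

For γ ≤ 2/3 the inequalities -𝒮 ≤ 1 + Σ² and 2q - (3γ - 2) ≥ 4Σ² are enough: `logDensity` absorbs
the shear, and `tiltEnergy` is O(e^(-2τ)).

For 2/3 < γ < 6/5 the shear has to be controlled by other means. The fluid helicity h obeys h' = (q
+ 2T)h, in which no shear component appears explicitly; it is O(e^(-(9 - 15γ/2)τ)), and this rate is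
positive exactly when γ < 6/5. Since |h| ≥ (|N̄| - |N_×|)|𝐯|², the helicity controls 𝐯 once the gap
|N̄| - |N_×| is bounded below, which follows from the monotonicity of `curvLyapunov`. Then 𝐯 → 0,
the second momentum constraint gives Σ₁ → 0, and the other sources of Σ₊ are nonpositive, so limsup
Σ₊ ≤ 0. Now -V²𝒮 is at most 2Σ₊V² plus decaying terms, and 3γ < 4 forces `tiltEnergy` to 0. -/

noncomputable section

namespace BianchiVII0

/-! ### Real-component forms of the variables. -/

namespace State

/-- `V²`, written in real components. -/
def Vsq (X : State) : ℝ := X.v1 ^ 2 + X.v.re ^ 2 + X.v.im ^ 2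

/-- `V² 𝒮 = Σ_ab v^a v^b`, written in real components. -/
def tiltShear (X : State) : ℝ :=
  X.Sp * (-2 * X.v1 ^ 2 + X.v.re ^ 2 + X.v.im ^ 2)
    + √3 * (X.Sx.re * (X.v.re ^ 2 - X.v.im ^ 2) + 2 * X.Sx.im * X.v.re * X.v.im)
    + 2 * √3 * X.v1 * (X.S1.re * X.v.re + X.S1.im * X.v.im)

/-- `|N_×|²`. -/
def Nsq (X : State) : ℝ := X.Nx.re ^ 2 + X.Nx.im ^ 2

/-- `N̄² - |N_×|²`, the determinant of the curvature matrix. -/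
def curvDet (X : State) : ℝ := X.Nbar ^ 2 - X.Nsq

/-- The fluid helicity `N̄ |𝐯|² + Re (N_×^* 𝐯²)`. -/
def helicity (X : State) : ℝ :=
  X.Nbar * (X.v.re ^ 2 + X.v.im ^ 2)
    + (X.Nx.re * (X.v.re ^ 2 - X.v.im ^ 2) + 2 * X.Nx.im * X.v.re * X.v.im)

/-- `Re (Σ_×^* N_×)`. -/
def shearCurv (X : State) : ℝ := X.Sx.re * X.Nx.re + X.Sx.im * X.Nx.im

/-- The momentum density coefficient `γ Ω / G₊`. -/
def om (γ : ℝ) (X : State) : ℝ := γ * X.Om / X.Gp γ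

variable (X : State)

lemma sq_norm_eq (z : ℂ) : ‖z‖ ^ 2 = z.re ^ 2 + z.im ^ 2 := by
  rw [Complex.sq_norm, Complex.normSq_apply]; ring

lemma V_sq : X.V ^ 2 = X.Vsq := by
  unfold V Vsq
  rw [Real.sq_sqrt (by positivity), sq_norm_eq]; ring

lemma Vsq_nonneg : 0 ≤ X.Vsq := by unfold Vsq; positivity

lemma V_sq_mul_calS : X.V ^ 2 * X.calS = X.tiltShear := by
  by_cases h : X.V = 0
  · have h2 : X.Vsq = 0 := by rw [← V_sq, h]; ring
    unfold Vsq at h2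
    have e1 : X.v1 = 0 := by nlinarith [sq_nonneg X.v1, sq_nonneg X.v.re, sq_nonneg X.v.im]
    have e2 : X.v.re = 0 := by nlinarith [sq_nonneg X.v1, sq_nonneg X.v.re, sq_nonneg X.v.im]
    have e3 : X.v.im = 0 := by nlinarith [sq_nonneg X.v1, sq_nonneg X.v.re, sq_nonneg X.v.im]
    simp [h, tiltShear, e1, e2, e3]
  · unfold calS dir shear tiltShear
    simp [Matrix.mulVec, dotProduct, Fin.sum_univ_three]
    field_simp
    ring

lemma Gp_eq (γ : ℝ) : X.Gp γ = 1 + (γ - 1) * X.Vsq := by rw [Gp, V_sq]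

lemma shearSq_eq : X.shearSq
    = X.Sp ^ 2 + (X.Sx.re ^ 2 + X.Sx.im ^ 2) + (X.S1.re ^ 2 + X.S1.im ^ 2) := by
  rw [shearSq, sq_norm_eq, sq_norm_eq]

lemma shearSq_nonneg : 0 ≤ X.shearSq := by unfold shearSq; positivity

lemma Nsq_nonneg : 0 ≤ X.Nsq := by unfold Nsq; positivity

lemma q_eq (γ : ℝ) : X.q γ = 2 * X.shearSq
    + 1 / 2 * (((3 * γ - 2) + (2 - γ) * X.Vsq) / X.Gp γ) * X.Om := by
  rw [q, Gp_eq, V_sq]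

lemma T_eq (γ : ℝ) : X.T γ = ((3 * γ - 4) * (1 - X.Vsq) + (2 - γ) * X.tiltShear)
    / (1 - (γ - 1) * X.Vsq) := by
  rw [T, mul_assoc, V_sq_mul_calS, V_sq]

/-- `-𝒮 V² ≤ (1 + Σ²) V²`. -/
lemma neg_tiltShear_le : -X.tiltShear ≤ (1 + X.shearSq) * X.Vsq := by
  have h3 : √3 * √3 = 3 := Real.mul_self_sqrt (by norm_num)
  rcases (X.Vsq_nonneg).eq_or_lt with h | h
  · have : X.tiltShear = 0 := by rw [← V_sq_mul_calS, V_sq, ← h]; ring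
    rw [this, ← h]; simp
  -- The squares are the components of V²Σ_ab + 3(v_a v_b - V²δ_ab/3), in the norm for which Σ² =
  -- Σ_ab Σ^ab / 6; the second tensor has norm V².
  · have key : X.Vsq * (X.tiltShear + (1 + X.shearSq) * X.Vsq)
        = (X.Vsq * X.Sp + (-2 * X.v1 ^ 2 + X.v.re ^ 2 + X.v.im ^ 2) / 2) ^ 2
        + (X.Vsq * X.Sx.re + √3 * (X.v.re ^ 2 - X.v.im ^ 2) / 2) ^ 2
        + (X.Vsq * X.Sx.im + √3 * X.v.re * X.v.im) ^ 2
        + (X.Vsq * X.S1.re + √3 * X.v1 * X.v.re) ^ 2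
        + (X.Vsq * X.S1.im + √3 * X.v1 * X.v.im) ^ 2 := by
      rw [shearSq_eq]
      unfold tiltShear Vsq
      linear_combination (-(X.v.re ^ 2 - X.v.im ^ 2) ^ 2 / 4 - X.v.re ^ 2 * X.v.im ^ 2
        - X.v1 ^ 2 * X.v.re ^ 2 - X.v1 ^ 2 * X.v.im ^ 2) * h3
    have : 0 ≤ X.tiltShear + (1 + X.shearSq) * X.Vsq := by
      refine nonneg_of_mul_nonneg_right (a := X.Vsq) ?_ h
      rw [key]; positivity
    linarith

end State

/-! ### Evolution equations in real components. -/

namespace IsEvolution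

variable {γ τ₀ : ℝ} {X : ℝ → State}

lemma hasDeriv_Sp (hX : IsEvolution γ τ₀ X) {τ : ℝ} (hτ : τ₀ ≤ τ) :
    HasDerivWithinAt (fun s => (X s).Sp)
      (((X τ).q γ - 2) * (X τ).Sp + 3 * ((X τ).S1.re ^ 2 + (X τ).S1.im ^ 2) - 2 * (X τ).Nsq
        + (X τ).om γ / 2 * (-2 * (X τ).v1 ^ 2 + (X τ).v.re ^ 2 + (X τ).v.im ^ 2))
      (Set.Ici τ₀) τ := by
  convert hX.deriv_Sp τ hτ using 1
  rw [State.sq_norm_eq, State.sq_norm_eq, State.sq_norm_eq, State.om, State.Nsq,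
    mul_comm 2 ((X τ).Gp γ), ← div_div]
  ring

lemma hasDeriv_re {f : ℝ → ℂ} {f' : ℂ} {s : Set ℝ} {τ : ℝ} (h : HasDerivWithinAt f f' s τ) :
    HasDerivWithinAt (fun t => (f t).re) f'.re s τ :=
  (Complex.reCLM.hasFDerivAt.comp_hasDerivWithinAt τ h)

lemma hasDeriv_im {f : ℝ → ℂ} {f' : ℂ} {s : Set ℝ} {τ : ℝ} (h : HasDerivWithinAt f f' s τ) :
    HasDerivWithinAt (fun t => (f t).im) f'.im s τ :=
  (Complex.imCLM.hasFDerivAt.comp_hasDerivWithinAt τ h)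

lemma hasDeriv_Sx_re (hX : IsEvolution γ τ₀ X) {τ : ℝ} (hτ : τ₀ ≤ τ) :
    HasDerivWithinAt (fun s => (X s).Sx.re)
      (((X τ).q γ - 2) * (X τ).Sx.re + √3 * ((X τ).S1.re ^ 2 - (X τ).S1.im ^ 2)
        - 2 * √3 * (X τ).Nx.re * (X τ).Nbar
        + √3 / 2 * (X τ).om γ * ((X τ).v.re ^ 2 - (X τ).v.im ^ 2)) (Set.Ici τ₀) τ := by
  convert hasDeriv_re (hX.deriv_Sx τ hτ) using 1
  rw [State.om, mul_comm 2 ((X τ).Gp γ), ← div_div]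
  generalize hG : (X τ).Gp γ = G
  generalize √3 = r
  simp [-Complex.ofReal_mul, -Complex.ofReal_div, pow_two, -Complex.ofReal_sub]
  left
  ring

lemma hasDeriv_Sx_im (hX : IsEvolution γ τ₀ X) {τ : ℝ} (hτ : τ₀ ≤ τ) :
    HasDerivWithinAt (fun s => (X s).Sx.im)
      (((X τ).q γ - 2) * (X τ).Sx.im + 2 * √3 * (X τ).S1.re * (X τ).S1.im
        - 2 * √3 * (X τ).Nx.im * (X τ).Nbar
        + √3 * (X τ).om γ * (X τ).v.re * (X τ).v.im) (Set.Ici τ₀) τ := by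
  convert hasDeriv_im (hX.deriv_Sx τ hτ) using 1
  rw [State.om, mul_comm 2 ((X τ).Gp γ), ← div_div]
  generalize hG : (X τ).Gp γ = G
  generalize √3 = r
  simp [-Complex.ofReal_mul, -Complex.ofReal_div, pow_two, -Complex.ofReal_sub]
  ring

lemma hasDeriv_Nx_re (hX : IsEvolution γ τ₀ X) {τ : ℝ} (hτ : τ₀ ≤ τ) :
    HasDerivWithinAt (fun s => (X s).Nx.re)
      (((X τ).q γ + 2 * (X τ).Sp) * (X τ).Nx.re + 2 * √3 * (X τ).Sx.re * (X τ).Nbar)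
      (Set.Ici τ₀) τ := by
  convert hasDeriv_re (hX.deriv_Nx τ hτ) using 1
  generalize √3 = r
  simp [-Complex.ofReal_mul, -Complex.ofReal_add]

lemma hasDeriv_Nx_im (hX : IsEvolution γ τ₀ X) {τ : ℝ} (hτ : τ₀ ≤ τ) :
    HasDerivWithinAt (fun s => (X s).Nx.im)
      (((X τ).q γ + 2 * (X τ).Sp) * (X τ).Nx.im + 2 * √3 * (X τ).Sx.im * (X τ).Nbar)
      (Set.Ici τ₀) τ := by
  convert hasDeriv_im (hX.deriv_Nx τ hτ) using 1
  generalize √3 = r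
  simp [-Complex.ofReal_mul, -Complex.ofReal_add]

lemma hasDeriv_Nbar (hX : IsEvolution γ τ₀ X) {τ : ℝ} (hτ : τ₀ ≤ τ) :
    HasDerivWithinAt (fun s => (X s).Nbar)
      (((X τ).q γ + 2 * (X τ).Sp) * (X τ).Nbar + 2 * √3 * (X τ).shearCurv) (Set.Ici τ₀) τ := by
  convert hX.deriv_Nbar τ hτ using 1
  simp [State.shearCurv]

lemma hasDeriv_v1 (hX : IsEvolution γ τ₀ X) {τ : ℝ} (hτ : τ₀ ≤ τ) :
    HasDerivWithinAt (fun s => (X s).v1)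
      (((X τ).T γ + 2 * (X τ).Sp) * (X τ).v1
        - 2 * √3 * ((X τ).S1.re * (X τ).v.re + (X τ).S1.im * (X τ).v.im)
        + √3 * (2 * (X τ).Nx.re * (X τ).v.re * (X τ).v.im
          - (X τ).Nx.im * ((X τ).v.re ^ 2 - (X τ).v.im ^ 2))) (Set.Ici τ₀) τ := by
  convert hX.deriv_v1 τ hτ using 1
  simp [pow_two]
  ring

lemma hasDeriv_v_re (hX : IsEvolution γ τ₀ X) {τ : ℝ} (hτ : τ₀ ≤ τ) :
    HasDerivWithinAt (fun s => (X s).v.re)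
      (((X τ).T γ - (X τ).Sp) * (X τ).v.re + √3 * (X τ).Nbar * (X τ).v1 * (X τ).v.im
        - √3 * (((X τ).Sx.re - (X τ).Nx.im * (X τ).v1) * (X τ).v.re
          + ((X τ).Sx.im + (X τ).Nx.re * (X τ).v1) * (X τ).v.im)) (Set.Ici τ₀) τ := by
  convert hasDeriv_re (hX.deriv_v τ hτ) using 1
  generalize √3 = r
  simp [-Complex.ofReal_mul, -Complex.ofReal_sub]
  ring

lemma hasDeriv_v_im (hX : IsEvolution γ τ₀ X) {τ : ℝ} (hτ : τ₀ ≤ τ) :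
    HasDerivWithinAt (fun s => (X s).v.im)
      (((X τ).T γ - (X τ).Sp) * (X τ).v.im - √3 * (X τ).Nbar * (X τ).v1 * (X τ).v.re
        - √3 * (((X τ).Sx.im + (X τ).Nx.re * (X τ).v1) * (X τ).v.re
          - ((X τ).Sx.re - (X τ).Nx.im * (X τ).v1) * (X τ).v.im)) (Set.Ici τ₀) τ := by
  convert hasDeriv_im (hX.deriv_v τ hτ) using 1
  generalize √3 = r
  simp [-Complex.ofReal_mul, -Complex.ofReal_sub]
  ring

/-- Curvature only rotates the velocity, so N_× and N̄ cancel. -/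
lemma hasDeriv_Vsq_aux (hX : IsEvolution γ τ₀ X) {τ : ℝ} (hτ : τ₀ ≤ τ) :
    HasDerivWithinAt (fun s => (X s).Vsq)
      (2 * (X τ).T γ * (X τ).Vsq - 2 * (X τ).tiltShear) (Set.Ici τ₀) τ := by
  refine ((((hX.hasDeriv_v1 hτ).pow 2).add ((hX.hasDeriv_v_re hτ).pow 2)).add
    ((hX.hasDeriv_v_im hτ).pow 2)).congr_deriv ?_
  unfold State.Vsq State.tiltShear
  push_cast
  ring

lemma hasDeriv_curvDet (hX : IsEvolution γ τ₀ X) {τ : ℝ} (hτ : τ₀ ≤ τ) :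
    HasDerivWithinAt (fun s => (X s).curvDet)
      (2 * ((X τ).q γ + 2 * (X τ).Sp) * (X τ).curvDet) (Set.Ici τ₀) τ := by
  refine (((hX.hasDeriv_Nbar hτ).pow 2).sub (((hX.hasDeriv_Nx_re hτ).pow 2).add
    ((hX.hasDeriv_Nx_im hτ).pow 2))).congr_deriv ?_
  unfold State.curvDet State.Nsq State.shearCurv
  push_cast
  ring

/-- The shear acting on the curvature cancels against the shear acting on 𝐯, and so do the rotation
terms with v₁; only the scalar rates q and 2T survive. -/
lemma hasDeriv_helicity (hX : IsEvolution γ τ₀ X) {τ : ℝ} (hτ : τ₀ ≤ τ) :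
    HasDerivWithinAt (fun s => (X s).helicity)
      (((X τ).q γ + 2 * (X τ).T γ) * (X τ).helicity) (Set.Ici τ₀) τ := by
  have h1 := hX.hasDeriv_v_re hτ
  have h2 := hX.hasDeriv_v_im hτ
  have h3 := ((hX.hasDeriv_Nbar hτ).mul ((h1.pow 2).add (h2.pow 2))).add
    (((hX.hasDeriv_Nx_re hτ).mul ((h1.pow 2).sub (h2.pow 2))).add
      ((((hX.hasDeriv_Nx_im hτ).const_mul 2).mul h1).mul h2))
  refine h3.congr_deriv ?_
  simp only [State.helicity, State.shearCurv, Pi.add_apply, Pi.sub_apply, Pi.pow_apply,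
    Pi.mul_apply]
  push_cast
  ring

end IsEvolution

/-! ### Scalar differential inequalities. -/

lemma monotoneOn_Ici_of_hasDeriv {f f' : ℝ → ℝ} {a : ℝ}
    (hf : ∀ t, a ≤ t → HasDerivWithinAt f (f' t) (Set.Ici a) t) (h : ∀ t, a ≤ t → 0 ≤ f' t) :
    MonotoneOn f (Set.Ici a) := by
  refine monotoneOn_of_hasDerivWithinAt_nonneg (f' := f') (convex_Ici a)
    (fun t ht => (hf t ht).continuousWithinAt) (fun t ht => ?_) (fun t ht => ?_)
  · exact (hf t (interior_subset ht)).mono interior_subset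
  · exact h t (interior_subset ht)

lemma antitoneOn_Ici_of_hasDeriv {f f' : ℝ → ℝ} {a : ℝ}
    (hf : ∀ t, a ≤ t → HasDerivWithinAt f (f' t) (Set.Ici a) t) (h : ∀ t, a ≤ t → f' t ≤ 0) :
    AntitoneOn f (Set.Ici a) := by
  refine antitoneOn_of_hasDerivWithinAt_nonpos (f' := f') (convex_Ici a)
    (fun t ht => (hf t ht).continuousWithinAt) (fun t ht => ?_) (fun t ht => ?_)
  · exact (hf t (interior_subset ht)).mono interior_subset
  · exact h t (interior_subset ht)

/-- A function that solves `f' = k f` as long as it is nonnegative, and starts positive, stays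
positive, if `k` is bounded on every initial interval on which `f` is nonnegative. -/
lemma pos_of_hasDeriv_mul_self {f f' k : ℝ → ℝ} {a : ℝ}
    (hf : ∀ t, a ≤ t → HasDerivWithinAt f (f' t) (Set.Ici a) t)
    (hf' : ∀ t, a ≤ t → 0 ≤ f t → f' t = k t * f t) (ha : 0 < f a)
    (hk : ∀ b, a ≤ b → (∀ t ∈ Set.Icc a b, 0 ≤ f t) → ∃ C, ∀ t ∈ Set.Icc a b, ‖k t‖ ≤ C) :
    ∀ t, a ≤ t → 0 < f t := by
  have hcont : ContinuousOn f (Set.Ici a) := fun t ht => (hf t ht).continuousWithinAt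
  by_contra! hcon
  obtain ⟨t₁, ht₁, hft₁⟩ := hcon
  set S : Set ℝ := Set.Ici a ∩ f ⁻¹' Set.Iic 0 with hS
  have hSc : IsClosed S := hcont.preimage_isClosed_of_isClosed isClosed_Ici isClosed_Iic
  have hbdd : BddBelow S := ⟨a, fun t ht => ht.1⟩
  have hmem : sInf S ∈ S := hSc.csInf_mem ⟨t₁, ht₁, hft₁⟩ hbdd
  set b := sInf S with hb
  have hpos : ∀ t, a ≤ t → t < b → 0 < f t := by
    intro t hat htb
    by_contra! h
    exact absurd (csInf_le hbdd (show t ∈ S from ⟨hat, h⟩)) (not_le.mpr htb)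
  have hab : a ≤ b := hmem.1
  have hfb : f b ≤ 0 := hmem.2
  have hab' : a < b := by
    rcases hab.eq_or_lt with h | h
    · rw [← h] at hfb; linarith
    · exact h
  have hfb0 : 0 ≤ f b := by
    have h1 : ContinuousOn f (Set.Icc a b) := hcont.mono Set.Icc_subset_Ici_self
    have h2 : Set.MapsTo f (Set.Ico a b) (Set.Ici 0) := fun t ht => (hpos t ht.1 ht.2).le
    have h3 := h2.closure_of_continuousOn (by rwa [closure_Ico hab'.ne])
    rw [closure_Ico hab'.ne, isClosed_Ici.closure_eq] at h3
    exact h3 ⟨hab, le_rfl⟩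
  have hnn : ∀ t ∈ Set.Icc a b, 0 ≤ f t := fun t ht => by
    rcases ht.2.eq_or_lt with h | h
    · rw [h]; exact hfb0
    · exact (hpos t ht.1 h).le
  obtain ⟨C, hC⟩ := hk b hab hnn
  -- Since k ≥ -C up to the first zero b, this weighted square cannot decrease from its positive
  -- value at a to 0 at b.
  have hmono : MonotoneOn (fun t => f t ^ 2 * Real.exp (2 * C * t)) (Set.Icc a b) := by
    refine monotoneOn_of_hasDerivWithinAt_nonneg
      (f' := fun t => 2 * (k t + C) * (f t ^ 2 * Real.exp (2 * C * t))) (convex_Icc a b)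
      (((hcont.mono Set.Icc_subset_Ici_self).pow 2).mul (by fun_prop)) (fun t ht => ?_)
      (fun t ht => ?_)
    · have ht' := interior_subset ht
      have h1 := (hf t ht'.1).mono
        ((interior_subset (s := Set.Icc a b)).trans Set.Icc_subset_Ici_self)
      have h2 : HasDerivWithinAt (fun t => Real.exp (2 * C * t))
          (Real.exp (2 * C * t) * (2 * C * 1)) (interior (Set.Icc a b)) t :=
        ((hasDerivAt_id t).const_mul (2 * C)).exp.hasDerivWithinAt
      refine ((h1.pow 2).mul h2).congr_deriv ?_
      rw [hf' t ht'.1 (hnn t ht')]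
      simp only [Pi.pow_apply]
      push_cast
      ring
    · have h1 := hC t (interior_subset ht)
      have h2 := neg_le_of_abs_le (by simpa using h1 : |k t| ≤ C)
      have : 0 ≤ k t + C := by linarith
      positivity
  have h := hmono ⟨le_rfl, hab⟩ ⟨hab, le_rfl⟩ hab
  have hz : f b = 0 := le_antisymm hfb hfb0
  have : 0 < f a ^ 2 * Real.exp (2 * C * a) := by positivity
  simp only [hz] at h
  norm_num at h
  linarith

/-- A function that decreases at a definite rate while it is at least `ε` is eventually at most
`ε`. -/
lemma eventually_le_of_hasDeriv {f f' : ℝ → ℝ} {a ε δ : ℝ} (hδ : 0 < δ)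
    (hf : ∀ t, a ≤ t → HasDerivWithinAt f (f' t) (Set.Ici a) t)
    (h : ∀ t, a ≤ t → ε ≤ f t → f' t ≤ -δ) : ∀ᶠ t in Filter.atTop, f t ≤ ε := by
  have hcont : ContinuousOn f (Set.Ici a) := fun t ht => (hf t ht).continuousWithinAt
  have h1 : ∃ t, a ≤ t ∧ f t ≤ ε := by
    by_contra! hcon
    have hanti : AntitoneOn (fun t => f t + δ * t) (Set.Ici a) :=
      antitoneOn_Ici_of_hasDeriv (f' := fun t => f' t + δ * 1)
        (fun t ht => (hf t ht).add ((hasDerivAt_id t).const_mul δ).hasDerivWithinAt)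
        (fun t ht => by linarith [h t ht (hcon t ht).le])
    -- By this time a decrease at rate δ has brought f down to ε.
    set t := a + (f a - ε) / δ with ht
    have hat : a ≤ t := by
      have : 0 ≤ (f a - ε) / δ := div_nonneg (by linarith [hcon a le_rfl]) hδ.le
      linarith
    have h2 : f t + δ * t ≤ f a + δ * a := hanti (Set.mem_Ici.2 le_rfl) hat hat
    have h3 : δ * t = δ * a + (f a - ε) := by rw [ht]; field_simp
    linarith [hcon t hat]
  obtain ⟨t₁, ht₁, hft₁⟩ := h1
  filter_upwards [Filter.eventually_ge_atTop t₁] with t ht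
  -- Once below ε, f cannot cross back, because its derivative is negative wherever f = ε.
  refine image_le_of_deriv_right_lt_deriv_boundary (f := f) (f' := f') (a := t₁) (b := t)
    (B := fun _ => ε) (B' := fun _ => 0) (hcont.mono fun s hs => ht₁.trans hs.1)
    (fun s hs => ?_) hft₁ (fun s => hasDerivAt_const s ε) (fun s hs hse => ?_) ⟨ht, le_rfl⟩
  · exact (hf s (ht₁.trans hs.1)).mono (Set.Ici_subset_Ici.2 (ht₁.trans hs.1))
  · linarith [h s (ht₁.trans hs.1) hse.ge]

/-! ### Density, tilt energy and persistence of admissibility. -/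

namespace State

/-- `log` of the comoving particle number density, `Ω (1 - V²)^((2 - γ) / 2) / G₊`. -/
def logDensity (γ : ℝ) (X : State) : ℝ :=
  Real.log X.Om + (2 - γ) / 2 * Real.log (1 - X.Vsq) - Real.log (X.Gp γ)

/-- `V² (1 - V²)^(-(2 - γ))`, a measure of the tilt that controls `V²`. -/
def tiltEnergy (γ : ℝ) (X : State) : ℝ :=
  X.Vsq * Real.exp (-(2 - γ) * Real.log (1 - X.Vsq))

/-- The conditions that persist along evolutions: subluminal tilt, positive energy density and
positive curvature determinant. -/
structure Admissible (X : State) : Prop where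
  Vsq_lt_one : X.Vsq < 1
  Om_pos : 0 < X.Om
  curvDet_pos : 0 < X.curvDet

lemma Gp_pos {γ : ℝ} (hγ : 0 < γ) {X : State} (h : X.Vsq < 1) : 0 < X.Gp γ := by
  rw [Gp_eq]; nlinarith [X.Vsq_nonneg]

lemma Gm_pos {γ : ℝ} (hγ : γ < 2) {X : State} (h : X.Vsq ≤ 1) : 0 < 1 - (γ - 1) * X.Vsq := by
  rcases le_or_gt X.Vsq (1 / 2) with h' | h' <;>
    nlinarith [mul_nonneg (sub_nonneg.2 hγ.le) X.Vsq_nonneg]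

end State

namespace IsEvolution

variable {γ τ₀ : ℝ} {X : ℝ → State}

lemma hasDeriv_Vsq (hX : IsEvolution γ τ₀ X) {τ : ℝ} (hτ : τ₀ ≤ τ)
    (h : 1 - (γ - 1) * (X τ).Vsq ≠ 0) :
    HasDerivWithinAt (fun s => (X s).Vsq)
      (2 * (1 - (X τ).Vsq) * ((3 * γ - 4) * (X τ).Vsq - (X τ).tiltShear)
        / (1 - (γ - 1) * (X τ).Vsq)) (Set.Ici τ₀) τ := by
  refine (hX.hasDeriv_Vsq_aux hτ).congr_deriv ?_
  have e : (X τ).T γ * (1 - (γ - 1) * (X τ).Vsq)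
      = (3 * γ - 4) * (1 - (X τ).Vsq) + (2 - γ) * (X τ).tiltShear := by
    rw [State.T_eq, div_mul_cancel₀ _ h]
  rw [eq_div_iff h]
  linear_combination 2 * (X τ).Vsq * e

lemma hasDeriv_Om (hX : IsEvolution γ τ₀ X) {τ : ℝ} (hτ : τ₀ ≤ τ) (h : (X τ).Gp γ ≠ 0) :
    HasDerivWithinAt (fun s => (X s).Om)
      ((2 * (X τ).q γ - ((3 * γ - 2) + (2 - γ) * (X τ).Vsq + γ * (X τ).tiltShear) / (X τ).Gp γ)
        * (X τ).Om) (Set.Ici τ₀) τ := by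
  refine (hX.deriv_Om τ hτ).congr_deriv ?_
  have e : (2 * (X τ).q γ * (γ - 1) - (2 - γ) - γ * (X τ).calS) * (X τ).V ^ 2
      = (2 * (X τ).q γ * (γ - 1) - (2 - γ)) * (X τ).Vsq - γ * (X τ).tiltShear := by
    rw [← State.V_sq_mul_calS, ← State.V_sq]; ring
  rw [e]
  field_simp
  rw [State.Gp_eq]
  ring

lemma continuousOn_Vsq (hX : IsEvolution γ τ₀ X) :
    ContinuousOn (fun s => (X s).Vsq) (Set.Ici τ₀) :=
  fun _ ht => (hX.hasDeriv_Vsq_aux ht).continuousWithinAt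

lemma continuousOn_tiltShear (hX : IsEvolution γ τ₀ X) :
    ContinuousOn (fun s => (X s).tiltShear) (Set.Ici τ₀) := by
  have h1 : ContinuousOn (fun s => (X s).Sp) (Set.Ici τ₀) :=
    fun _ ht => (hX.deriv_Sp _ ht).continuousWithinAt
  have h2 : ContinuousOn (fun s => (X s).Sx) (Set.Ici τ₀) :=
    fun _ ht => (hX.deriv_Sx _ ht).continuousWithinAt
  have h3 : ContinuousOn (fun s => (X s).S1) (Set.Ici τ₀) :=
    fun _ ht => (hX.deriv_S1 _ ht).continuousWithinAt
  have h4 : ContinuousOn (fun s => (X s).v1) (Set.Ici τ₀) :=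
    fun _ ht => (hX.deriv_v1 _ ht).continuousWithinAt
  have h5 : ContinuousOn (fun s => (X s).v) (Set.Ici τ₀) :=
    fun _ ht => (hX.deriv_v _ ht).continuousWithinAt
  have r2 := Complex.continuous_re.comp_continuousOn h2
  have i2 := Complex.continuous_im.comp_continuousOn h2
  have r3 := Complex.continuous_re.comp_continuousOn h3
  have i3 := Complex.continuous_im.comp_continuousOn h3
  have r5 := Complex.continuous_re.comp_continuousOn h5
  have i5 := Complex.continuous_im.comp_continuousOn h5
  simp only [Function.comp_def] at r2 i2 r3 i3 r5 i5
  unfold State.tiltShear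
  fun_prop

lemma continuousOn_Gp (hX : IsEvolution γ τ₀ X) :
    ContinuousOn (fun s => (X s).Gp γ) (Set.Ici τ₀) := by
  have := hX.continuousOn_Vsq
  simp only [State.Gp_eq]
  fun_prop

lemma continuousOn_q (hX : IsEvolution γ τ₀ X) (hG : ∀ τ, τ₀ ≤ τ → (X τ).Gp γ ≠ 0) :
    ContinuousOn (fun s => (X s).q γ) (Set.Ici τ₀) := by
  have h0 := hX.continuousOn_Vsq
  have h1 : ContinuousOn (fun s => (X s).Sp) (Set.Ici τ₀) :=
    fun _ ht => (hX.deriv_Sp _ ht).continuousWithinAt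
  have h2 : ContinuousOn (fun s => (X s).Sx) (Set.Ici τ₀) :=
    fun _ ht => (hX.deriv_Sx _ ht).continuousWithinAt
  have h3 : ContinuousOn (fun s => (X s).S1) (Set.Ici τ₀) :=
    fun _ ht => (hX.deriv_S1 _ ht).continuousWithinAt
  have h4 : ContinuousOn (fun s => (X s).Om) (Set.Ici τ₀) :=
    fun _ ht => (hX.deriv_Om _ ht).continuousWithinAt
  have h5 : ContinuousOn (fun s => ((3 * γ - 2) + (2 - γ) * (X s).Vsq) / (X s).Gp γ)
      (Set.Ici τ₀) := ContinuousOn.div (by fun_prop) hX.continuousOn_Gp hG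
  simp only [State.q_eq, State.shearSq]
  fun_prop

lemma exists_bound {k : ℝ → ℝ} {a b : ℝ} (hk : ContinuousOn k (Set.Icc a b)) :
    ∃ C, ∀ t ∈ Set.Icc a b, ‖k t‖ ≤ C :=
  isCompact_Icc.exists_bound_of_continuousOn hk

/-- The function 1 - V² solves f' = kf, where k has denominator 1 - (γ - 1)V². That denominator is
known to be nonzero only while V² ≤ 1, hence the restriction to f ≥ 0 in `pos_of_hasDeriv_mul_self`.
-/
lemma Vsq_lt_one (hX : IsEvolution γ τ₀ X) (hγ₁ : γ < 2) (hV : (X τ₀).Vsq < 1) {τ : ℝ}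
    (hτ : τ₀ ≤ τ) : (X τ).Vsq < 1 := by
  suffices h : ∀ t, τ₀ ≤ t → 0 < 1 - (X t).Vsq by linarith [h τ hτ]
  refine pos_of_hasDeriv_mul_self (f := fun t => 1 - (X t).Vsq)
    (k := fun t => -(2 * ((3 * γ - 4) * (X t).Vsq - (X t).tiltShear)
      / (1 - (γ - 1) * (X t).Vsq))) (fun t ht => (hX.hasDeriv_Vsq_aux ht).const_sub 1)
    (fun t ht hVt => ?_) (by simpa using hV) (fun b hb hVb => ?_)
  · have h := (State.Gm_pos hγ₁ (sub_nonneg.1 hVt)).ne'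
    have e : (X t).T γ * (1 - (γ - 1) * (X t).Vsq)
        = (3 * γ - 4) * (1 - (X t).Vsq) + (2 - γ) * (X t).tiltShear := by
      rw [State.T_eq, div_mul_cancel₀ _ h]
    rw [neg_mul, div_mul_eq_mul_div, neg_inj, eq_div_iff h]
    linear_combination 2 * (X t).Vsq * e
  · have h1 := hX.continuousOn_Vsq.mono (Set.Icc_subset_Ici_self : Set.Icc τ₀ b ⊆ _)
    have h2 := hX.continuousOn_tiltShear.mono (Set.Icc_subset_Ici_self : Set.Icc τ₀ b ⊆ _)
    exact exists_bound (ContinuousOn.neg (ContinuousOn.div (by fun_prop) (by fun_prop)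
      fun t ht => (State.Gm_pos hγ₁ (sub_nonneg.1 (hVb t ht))).ne'))

lemma admissible (hX : IsEvolution γ τ₀ X) (hγ₀ : 0 < γ) (hγ₁ : γ < 2) (h₀ : (X τ₀).Admissible)
    {τ : ℝ} (hτ : τ₀ ≤ τ) : (X τ).Admissible := by
  have hV : ∀ t, τ₀ ≤ t → (X t).Vsq < 1 := fun t ht => hX.Vsq_lt_one hγ₁ h₀.Vsq_lt_one ht
  have hG : ∀ t, τ₀ ≤ t → (X t).Gp γ ≠ 0 := fun t ht => (State.Gp_pos hγ₀ (hV t ht)).ne'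
  have hq := hX.continuousOn_q hG
  have h1 := hX.continuousOn_Vsq
  have h2 := hX.continuousOn_tiltShear
  have h3 : ContinuousOn (fun s => (X s).Sp) (Set.Ici τ₀) :=
    fun _ ht => (hX.deriv_Sp _ ht).continuousWithinAt
  refine ⟨hV τ hτ, ?_, ?_⟩
  · refine pos_of_hasDeriv_mul_self (fun t ht => hX.hasDeriv_Om ht (hG t ht))
      (fun _ _ _ => rfl) h₀.Om_pos (fun b hb _ => exists_bound (ContinuousOn.mono ?_
        Set.Icc_subset_Ici_self)) τ hτ
    exact ContinuousOn.sub (by fun_prop)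
      (ContinuousOn.div (by fun_prop) hX.continuousOn_Gp hG)
  · refine pos_of_hasDeriv_mul_self (fun t ht => hX.hasDeriv_curvDet ht)
      (fun _ _ _ => rfl) h₀.curvDet_pos (fun b hb _ => exists_bound (ContinuousOn.mono ?_
        Set.Icc_subset_Ici_self)) τ hτ
    fun_prop

lemma hasDeriv_log_one_sub_Vsq (hX : IsEvolution γ τ₀ X) (hγ₁ : γ < 2) {τ : ℝ} (hτ : τ₀ ≤ τ)
    (h : (X τ).Admissible) :
    HasDerivWithinAt (fun s => Real.log (1 - (X s).Vsq))
      (-(2 * ((3 * γ - 4) * (X τ).Vsq - (X τ).tiltShear) / (1 - (γ - 1) * (X τ).Vsq)))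
      (Set.Ici τ₀) τ := by
  have h1 : 1 - (X τ).Vsq ≠ 0 := by linarith [h.Vsq_lt_one]
  have h2 := (State.Gm_pos hγ₁ h.Vsq_lt_one.le).ne'
  refine (((hX.hasDeriv_Vsq hτ h2).const_sub 1).log h1).congr_deriv ?_
  generalize 1 - (γ - 1) * (X τ).Vsq = d at *
  field_simp

/-- The weight (2 - γ)/2 on log(1 - V²) makes all the tilt terms cancel, leaving only q. -/
lemma hasDeriv_logDensity (hX : IsEvolution γ τ₀ X) (hγ₀ : 0 < γ) (hγ₁ : γ < 2) {τ : ℝ}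
    (hτ : τ₀ ≤ τ) (h : (X τ).Admissible) :
    HasDerivWithinAt (fun s => (X s).logDensity γ) (2 * (X τ).q γ - (3 * γ - 2))
      (Set.Ici τ₀) τ := by
  have h2 := (State.Gm_pos hγ₁ h.Vsq_lt_one.le).ne'
  have hG := (State.Gp_pos hγ₀ h.Vsq_lt_one).ne'
  have hO := h.Om_pos.ne'
  have dG : HasDerivWithinAt (fun s => (X s).Gp γ) _ (Set.Ici τ₀) τ :=
    (((hX.hasDeriv_Vsq hτ h2).const_mul (γ - 1)).const_add 1).congr_of_mem
      (fun s _ => State.Gp_eq _ _) hτ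
  refine ((((hX.hasDeriv_Om hτ hG).log hO).add
    ((hX.hasDeriv_log_one_sub_Vsq hγ₁ hτ h).const_mul ((2 - γ) / 2))).sub
    (dG.log hG)).congr_deriv ?_
  have e := State.Gp_eq (X τ) γ
  generalize hd : 1 - (γ - 1) * (X τ).Vsq = d at *
  generalize (X τ).Gp γ = G at *
  rw [mul_div_assoc _ (X τ).Om, div_self hO]
  field_simp
  rw [e, ← hd]
  ring

/-- The exponent 2 - γ is the one that cancels the denominator, since (1 - V²) + (2 - γ)V² = 1 - (γ
- 1)V². -/
lemma hasDeriv_tiltEnergy (hX : IsEvolution γ τ₀ X) (hγ₁ : γ < 2) {τ : ℝ}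
    (hτ : τ₀ ≤ τ) (h : (X τ).Admissible) :
    HasDerivWithinAt (fun s => (X s).tiltEnergy γ)
      (Real.exp (-(2 - γ) * Real.log (1 - (X τ).Vsq))
        * (2 * ((3 * γ - 4) * (X τ).Vsq - (X τ).tiltShear))) (Set.Ici τ₀) τ := by
  have h2 := (State.Gm_pos hγ₁ h.Vsq_lt_one.le).ne'
  refine ((hX.hasDeriv_Vsq hτ h2).mul
    ((hX.hasDeriv_log_one_sub_Vsq hγ₁ hτ h).const_mul (-(2 - γ))).exp).congr_deriv ?_
  generalize Real.exp (-(2 - γ) * Real.log (1 - (X τ).Vsq)) = E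
  generalize hd : 1 - (γ - 1) * (X τ).Vsq = d at *
  field_simp
  rw [← hd]
  ring

end IsEvolution

/-! ### Pointwise bounds from the Friedmann constraint. -/

namespace State

variable {γ : ℝ} {X : State}

lemma Constraints.friedmann_eq (hc : X.Constraints γ) : X.shearSq + X.Nsq + X.Om = 1 := by
  have := hc.friedmann
  rw [sq_norm_eq] at this
  exact this.symm

lemma om_nonneg (hγ₀ : 0 < γ) (h : X.Admissible) : 0 ≤ X.om γ := by
  have := Gp_pos hγ₀ h.Vsq_lt_one
  have := h.Om_pos
  unfold om; positivity

/-- `2 q - (3 γ - 2)` in terms of shear, curvature and tilt. -/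
lemma two_q_sub (hγ₀ : 0 < γ) (h : X.Admissible) (hc : X.Constraints γ) :
    2 * X.q γ - (3 * γ - 2) = (4 - (3 * γ - 2)) * X.shearSq - (3 * γ - 2) * X.Nsq
      + (4 - 3 * γ) * X.Vsq * X.om γ := by
  have hG := (Gp_pos hγ₀ h.Vsq_lt_one).ne'
  have e := hc.friedmann_eq
  have e' := Gp_eq X γ
  rw [q_eq, om]
  generalize X.Gp γ = G at *
  have e1 : X.shearSq = 1 - X.Nsq - X.Om := by linarith
  rw [e1]
  field_simp
  rw [e']
  ring

lemma q_le_two (hγ₀ : 0 < γ) (hγ₁ : γ < 2) (h : X.Admissible) (hc : X.Constraints γ) :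
    X.q γ ≤ 2 := by
  have h1 := two_q_sub hγ₀ h hc
  have hG := Gp_pos hγ₀ h.Vsq_lt_one
  have e := hc.friedmann_eq
  have e1 : X.om γ * X.Gp γ = γ * X.Om := by rw [om, div_mul_cancel₀ _ hG.ne']
  rw [Gp_eq] at e1
  have h2 := X.Vsq_nonneg
  have h3 := om_nonneg hγ₀ h
  have h4 : γ * ((4 - 3 * γ) * X.Vsq * X.om γ) ≤ γ * ((4 - (3 * γ - 2)) * X.Om) := by
    nlinarith [mul_nonneg h2 h3, mul_nonneg h3 (sub_nonneg.2 h.Vsq_lt_one.le),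
      mul_nonneg (mul_nonneg h3 (sub_nonneg.2 h.Vsq_lt_one.le)) (sub_nonneg.2 hγ₁.le),
      mul_nonneg (mul_nonneg h3 h2) hγ₀.le]
  have h5 := le_of_mul_le_mul_left h4 hγ₀
  nlinarith [X.Nsq_nonneg]

/-- Each factor is bounded: Ω ≤ 1, 1 - V² ≤ 1 and G₊ ≥ min(1, γ). -/
lemma logDensity_le (hγ₀ : 0 < γ) (hγ₁ : γ < 2) (h : X.Admissible) (hc : X.Constraints γ) :
    X.logDensity γ ≤ -Real.log (min 1 γ) := by
  have h1 : Real.log X.Om ≤ 0 := Real.log_nonpos h.Om_pos.le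
    (by linarith [hc.friedmann_eq, X.shearSq_nonneg, X.Nsq_nonneg])
  have h2 : Real.log (1 - X.Vsq) ≤ 0 := Real.log_nonpos (by linarith [h.Vsq_lt_one])
    (by linarith [X.Vsq_nonneg])
  have h3 : Real.log (min 1 γ) ≤ Real.log (X.Gp γ) := by
    refine Real.log_le_log (by positivity) ?_
    rw [Gp_eq]
    rcases le_total 1 γ with h' | h'
    · rw [min_eq_left h']; nlinarith [X.Vsq_nonneg]
    · rw [min_eq_right h']; nlinarith [X.Vsq_nonneg, h.Vsq_lt_one]
  unfold logDensity
  nlinarith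

lemma Vsq_le_tiltEnergy (hγ₁ : γ < 2) (h : X.Admissible) : X.Vsq ≤ X.tiltEnergy γ := by
  have h2 : Real.log (1 - X.Vsq) ≤ 0 := Real.log_nonpos (by linarith [h.Vsq_lt_one])
    (by linarith [X.Vsq_nonneg])
  have : 1 ≤ Real.exp (-(2 - γ) * Real.log (1 - X.Vsq)) := Real.one_le_exp (by nlinarith)
  unfold tiltEnergy
  nlinarith [X.Vsq_nonneg]

end State

/-! ### Lower bound on the curvature gap. -/

/-- `Re (n^* z²) ≤ r |z|²` whenever `|n| ≤ r`. -/
lemma quadratic_le {m n r d e : ℝ} (hr : 0 ≤ r) (h : m ^ 2 + n ^ 2 ≤ r ^ 2) :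
    m * (d ^ 2 - e ^ 2) + 2 * n * d * e ≤ r * (d ^ 2 + e ^ 2) := by
  refine le_of_sq_le_sq ?_ (by positivity)
  -- Re(n^* z²)² + Im(n^* z²)² = |n|²|z|⁴.
  nlinarith [sq_nonneg (n * (d ^ 2 - e ^ 2) - 2 * m * d * e),
    mul_le_mul_of_nonneg_right h (sq_nonneg (d ^ 2 + e ^ 2))]

lemma quadratic_div_le {m n N d e : ℝ} (h : m ^ 2 + n ^ 2 < N ^ 2) :
    (m * (d ^ 2 - e ^ 2) + 2 * n * d * e) / N ≤ d ^ 2 + e ^ 2 := by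
  have hN : N ≠ 0 := by rintro rfl; nlinarith [sq_nonneg m, sq_nonneg n]
  rcases lt_or_gt_of_ne hN with h' | h'
  · rw [div_le_iff_of_neg h']
    have := quadratic_le (m := -m) (n := -n) (r := -N) (d := d) (e := e) (by linarith)
      (by nlinarith)
    linarith
  · rw [div_le_iff₀ h']
    have := quadratic_le (d := d) (e := e) h'.le h.le
    linarith

namespace State

lemma Admissible.Nbar_ne_zero {X : State} (h : X.Admissible) : X.Nbar ≠ 0 := by
  intro h0
  have := h.curvDet_pos
  unfold curvDet at this
  rw [h0] at this
  nlinarith [X.Nsq_nonneg]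

lemma Admissible.sq_shearCurv_div_le {X : State} (h : X.Admissible) :
    (X.shearCurv / X.Nbar) ^ 2 ≤ X.Sx.re ^ 2 + X.Sx.im ^ 2 := by
  have hN := h.Nbar_ne_zero
  have hD := h.curvDet_pos
  rw [div_pow, div_le_iff₀ (by positivity)]
  unfold curvDet Nsq at hD
  unfold shearCurv
  nlinarith [sq_nonneg (X.Sx.re * X.Nx.im - X.Sx.im * X.Nx.re),
    mul_nonneg (add_nonneg (sq_nonneg X.Sx.re) (sq_nonneg X.Sx.im)) hD.le]

/-- `Re (N_×^* Σ₁²)`. -/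
def curvS1 (X : State) : ℝ :=
  X.Nx.re * (X.S1.re ^ 2 - X.S1.im ^ 2) + 2 * X.Nx.im * X.S1.re * X.S1.im

/-- `Re (N_×^* 𝐯²)`. -/
def curvV (X : State) : ℝ :=
  X.Nx.re * (X.v.re ^ 2 - X.v.im ^ 2) + 2 * X.Nx.im * X.v.re * X.v.im

/-- A function that is nondecreasing along evolutions if `2/3 < γ < 6/5`. -/
def curvLyapunov (γ : ℝ) (X : State) : ℝ :=
  Real.log X.curvDet - Real.log X.Nbar + (X.Sp - √3 * (X.shearCurv / X.Nbar))
    + 4 / (3 * γ - 2) * X.logDensity γ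

/-- The derivative of `curvLyapunov` along evolutions. -/
def curvLyapunovDeriv (γ : ℝ) (X : State) : ℝ :=
  X.q γ * (1 + X.Sp - √3 * (X.shearCurv / X.Nbar)) + 4 * X.Nsq
    - 6 * (X.Sx.re ^ 2 + X.Sx.im ^ 2 - (X.shearCurv / X.Nbar) ^ 2)
    + 3 * (X.S1.re ^ 2 + X.S1.im ^ 2 - X.curvS1 / X.Nbar)
    + X.om γ / 2 * (X.v.re ^ 2 + X.v.im ^ 2 - 3 * (X.curvV / X.Nbar)) - X.om γ * X.v1 ^ 2
    + 4 / (3 * γ - 2) * (2 * X.q γ - (3 * γ - 2))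

/-- The weight 4/(3γ - 2) makes the density term contribute -4|N_×|², cancelling +4|N_×|². Its shear
and tilt terms are at least 6Σ² and γΩV²/G₊ precisely when γ ≤ 6/5, which pays for -6|Σ_×|² and for
the tilt losses. What remains is bounded below by the quadratic form in `hmain`. -/
lemma curvLyapunovDeriv_nonneg {γ : ℝ} {X : State} (hγ : 2 / 3 < γ) (hγ₁ : γ < 6 / 5)
    (h : X.Admissible) (hc : X.Constraints γ) : 0 ≤ X.curvLyapunovDeriv γ := by
  have hγ₀ : 0 < γ := by linarith
  have hD := h.curvDet_pos
  have hN := h.Nbar_ne_zero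
  unfold curvDet at hD
  have hS1 : X.curvS1 / X.Nbar ≤ X.S1.re ^ 2 + X.S1.im ^ 2 :=
    quadratic_div_le (by unfold Nsq at hD; linarith)
  have hv : X.curvV / X.Nbar ≤ X.v.re ^ 2 + X.v.im ^ 2 :=
    quadratic_div_le (by unfold Nsq at hD; linarith)
  have hω := om_nonneg hγ₀ h
  have hg : 0 < 3 * γ - 2 := by linarith
  have hz : 6 * X.shearSq - 4 * X.Nsq + X.Vsq * X.om γ
      ≤ 4 / (3 * γ - 2) * (2 * X.q γ - (3 * γ - 2)) := by
    rw [two_q_sub hγ₀ h hc, div_mul_eq_mul_div, le_div_iff₀ hg]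
    nlinarith [mul_nonneg (sub_nonneg.2 hγ₁.le) X.shearSq_nonneg,
      mul_nonneg (sub_nonneg.2 hγ₁.le) (mul_nonneg X.Vsq_nonneg hω)]
  have hq2 := q_le_two hγ₀ (by linarith) h hc
  have hq0 : 0 ≤ X.q γ := by
    have := Gp_pos hγ₀ h.Vsq_lt_one
    have h1 := h.Om_pos
    have h2 := X.Vsq_nonneg
    have h3 := X.shearSq_nonneg
    have h4 : 0 < 2 - γ := by linarith
    rw [q_eq]
    positivity
  have hω' : X.om γ * (X.v1 ^ 2 + (X.v.re ^ 2 + X.v.im ^ 2)) = X.Vsq * X.om γ := by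
    unfold Vsq; ring
  have h1 := mul_le_mul_of_nonneg_left hv hω
  set x := X.shearCurv / X.Nbar with hx
  have hx2 : x ^ 2 ≤ X.Sx.re ^ 2 + X.Sx.im ^ 2 := h.sq_shearCurv_div_le
  have hS : X.shearSq = X.Sp ^ 2 + (X.Sx.re ^ 2 + X.Sx.im ^ 2)
    + (X.S1.re ^ 2 + X.S1.im ^ 2) := X.shearSq_eq
  have h3 : √3 * √3 = 3 := Real.mul_self_sqrt (by norm_num)
  have hmain : 0 ≤ X.q γ * (1 + X.Sp - √3 * x) + 6 * (X.Sp ^ 2 + x ^ 2) := by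
    rcases le_total 0 (1 + X.Sp - √3 * x) with h' | h'
    · positivity
    -- With q replaced by 2, completing squares in Σ₊ and x leaves the constant 2 - 1/6 - 1/2 > 0.
    · have : 2 * (1 + X.Sp - √3 * x) ≤ X.q γ * (1 + X.Sp - √3 * x) :=
        mul_le_mul_of_nonpos_right hq2 h'
      nlinarith [sq_nonneg (6 * X.Sp + 1), sq_nonneg (6 * x - √3)]
  unfold curvLyapunovDeriv
  rw [← hx]
  nlinarith [sq_nonneg X.S1.re, sq_nonneg X.S1.im]

end State

namespace IsEvolution

variable {γ τ₀ : ℝ} {X : ℝ → State}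

lemma hasDeriv_shearCurv_div (hX : IsEvolution γ τ₀ X) {τ : ℝ} (hτ : τ₀ ≤ τ)
    (h : (X τ).Admissible) :
    HasDerivWithinAt (fun s => (X s).shearCurv / (X s).Nbar)
      (((X τ).q γ - 2) * ((X τ).shearCurv / (X τ).Nbar)
        + 2 * √3 * ((X τ).Sx.re ^ 2 + (X τ).Sx.im ^ 2 - (X τ).Nsq
          - ((X τ).shearCurv / (X τ).Nbar) ^ 2)
        + √3 * ((X τ).curvS1 / (X τ).Nbar + (X τ).om γ / 2 * ((X τ).curvV / (X τ).Nbar)))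
      (Set.Ici τ₀) τ := by
  have hN := h.Nbar_ne_zero
  refine ((((hX.hasDeriv_Sx_re hτ).mul (hX.hasDeriv_Nx_re hτ)).add
    ((hX.hasDeriv_Sx_im hτ).mul (hX.hasDeriv_Nx_im hτ))).div (hX.hasDeriv_Nbar hτ)
      hN).congr_deriv ?_
  simp only [Pi.add_apply, Pi.mul_apply]
  unfold State.curvS1 State.curvV State.shearCurv State.Nsq
  field_simp
  ring

lemma hasDeriv_curvLyapunov (hX : IsEvolution γ τ₀ X) (hγ₀ : 0 < γ) (hγ₁ : γ < 2) {τ : ℝ}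
    (hτ : τ₀ ≤ τ) (h : (X τ).Admissible) :
    HasDerivWithinAt (fun s => (X s).curvLyapunov γ) ((X τ).curvLyapunovDeriv γ)
      (Set.Ici τ₀) τ := by
  have hN := h.Nbar_ne_zero
  have hD := h.curvDet_pos.ne'
  have h3 : √3 * √3 = 3 := Real.mul_self_sqrt (by norm_num)
  refine (((((hX.hasDeriv_curvDet hτ).log hD).sub ((hX.hasDeriv_Nbar hτ).log hN)).add
    ((hX.hasDeriv_Sp hτ).sub ((hX.hasDeriv_shearCurv_div hτ h).const_mul √3))).add
    ((hX.hasDeriv_logDensity hγ₀ hγ₁ hτ h).const_mul (4 / (3 * γ - 2)))).congr_deriv ?_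
  have e1 : 2 * ((X τ).q γ + 2 * (X τ).Sp) * (X τ).curvDet / (X τ).curvDet
      = 2 * ((X τ).q γ + 2 * (X τ).Sp) := by field_simp
  have e2 : (((X τ).q γ + 2 * (X τ).Sp) * (X τ).Nbar + 2 * √3 * (X τ).shearCurv) / (X τ).Nbar
      = (X τ).q γ + 2 * (X τ).Sp + 2 * √3 * ((X τ).shearCurv / (X τ).Nbar) := by field_simp
  rw [e1, e2]
  unfold State.curvLyapunovDeriv
  generalize (X τ).shearCurv / (X τ).Nbar = x
  generalize (X τ).curvS1 / (X τ).Nbar = y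
  generalize (X τ).curvV / (X τ).Nbar = w
  linear_combination (-2 * ((X τ).Sx.re ^ 2 + (X τ).Sx.im ^ 2 - (X τ).Nsq - x ^ 2)
    - (y + (X τ).om γ / 2 * w)) * h3

/-- The smaller eigenvalue of the curvature matrix stays bounded away from zero. -/
lemma exists_curvDet_lower_bound (hX : IsEvolution γ τ₀ X) (hγ : 2 / 3 < γ) (hγ₁ : γ < 6 / 5)
    (hA : ∀ τ, τ₀ ≤ τ → (X τ).Admissible) :
    ∃ c > 0, ∀ τ, τ₀ ≤ τ → c * |(X τ).Nbar| ≤ (X τ).curvDet := by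
  have hγ₀ : 0 < γ := by linarith
  have hmono := monotoneOn_Ici_of_hasDeriv
    (fun t ht => hX.hasDeriv_curvLyapunov hγ₀ (by linarith) ht (hA t ht))
    (fun t ht => State.curvLyapunovDeriv_nonneg hγ hγ₁ (hA t ht) (hX.constraints t ht))
  set B := 4 / (3 * γ - 2) * -Real.log (min 1 γ) with hB
  -- The 3 bounds Σ₊ - √3 Re(Σ_×^* N_×)/N̄ and B bounds the weighted `logDensity`; the rest of
  -- `curvLyapunov` is the logarithm of `curvDet` / |N̄|.
  refine ⟨Real.exp ((X τ₀).curvLyapunov γ - 3 - B), Real.exp_pos _, fun τ hτ => ?_⟩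
  have h := hA τ hτ
  have hc := hX.constraints τ hτ
  have hN := h.Nbar_ne_zero
  have h1 : (X τ₀).curvLyapunov γ ≤ (X τ).curvLyapunov γ := hmono (Set.mem_Ici.2 le_rfl) hτ hτ
  have h2 : 4 / (3 * γ - 2) * (X τ).logDensity γ ≤ B := by
    have : 0 < 3 * γ - 2 := by linarith
    exact mul_le_mul_of_nonneg_left (State.logDensity_le hγ₀ (by linarith) h hc) (by positivity)
  have h3 : √3 * √3 = 3 := Real.mul_self_sqrt (by norm_num)
  have hF := hc.friedmann_eq
  have hS := (X τ).shearSq_eq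
  have hD := h.curvDet_pos
  have h4 : (X τ).Sp - √3 * ((X τ).shearCurv / (X τ).Nbar) ≤ 3 := by
    have hx2 := h.sq_shearCurv_div_le
    nlinarith [sq_nonneg ((X τ).shearCurv / (X τ).Nbar + √3 / 2), sq_nonneg ((X τ).Sp - 1),
      (X τ).Nsq_nonneg, h.Om_pos, sq_nonneg (X τ).S1.re, sq_nonneg (X τ).S1.im,
      sq_nonneg (√3 * ((X τ).shearCurv / (X τ).Nbar) + 2)]
  have h5 : (X τ₀).curvLyapunov γ - 3 - B ≤ Real.log (X τ).curvDet - Real.log |(X τ).Nbar| := by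
    -- `Real.log` ignores the sign of its argument, so N̄ < 0 needs no separate treatment.
    rw [Real.log_abs]
    conv at h1 => rhs; unfold State.curvLyapunov
    linarith
  have hNp : 0 < |(X τ).Nbar| := abs_pos.2 hN
  rw [← Real.log_div hD.ne' hNp.ne', Real.le_log_iff_exp_le (by positivity),
    le_div_iff₀ hNp] at h5
  exact h5

end IsEvolution

lemma tendsto_exp_sub_mul_atTop (b : ℝ) {c : ℝ} (hc : 0 < c) :
    Filter.Tendsto (fun τ : ℝ => Real.exp (b - c * τ)) Filter.atTop (nhds 0) := by
  refine Real.tendsto_exp_atBot.comp ?_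
  simp_rw [sub_eq_add_neg]
  exact Filter.tendsto_atBot_add_const_left _ _
    (Filter.tendsto_neg_atTop_atBot.comp (Filter.tendsto_id.const_mul_atTop hc))

lemma tendsto_const_mul_exp (a b : ℝ) {c : ℝ} (hc : 0 < c) :
    Filter.Tendsto (fun τ : ℝ => a * Real.exp (b - c * τ)) Filter.atTop (nhds 0) := by
  simpa using (tendsto_exp_sub_mul_atTop b hc).const_mul a

/-! ### Pointwise consequences of the curvature gap. -/

namespace State

variable {γ : ℝ} {X : State}

lemma om_le_two (hγ₀ : 0 < γ) (hγ₁ : γ < 2) (h : X.Admissible) (hc : X.Constraints γ) :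
    X.om γ ≤ 2 := by
  have hG := Gp_pos hγ₀ h.Vsq_lt_one
  rw [om, div_le_iff₀ hG, Gp_eq]
  have h1 : X.Om ≤ 1 := by linarith [hc.friedmann_eq, X.shearSq_nonneg, X.Nsq_nonneg]
  have h2 : γ * X.Om ≤ γ := by nlinarith
  rcases le_total 1 γ with h' | h'
  · nlinarith [X.Vsq_nonneg]
  · nlinarith [X.Vsq_nonneg, h.Vsq_lt_one]

/-- The gap `|N̄| - |N_×|` is at least half the constant `c` in `c |N̄| ≤ N̄² - |N_×|²`. -/
lemma half_le_sub_sqrt_Nsq {c : ℝ} (hc : 0 < c) (h : X.Admissible)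
    (hD : c * |X.Nbar| ≤ X.curvDet) : c / 2 ≤ |X.Nbar| - √X.Nsq := by
  have hN : 0 < |X.Nbar| := abs_pos.2 h.Nbar_ne_zero
  have h1 := Real.sq_sqrt X.Nsq_nonneg
  have h2 := Real.sqrt_nonneg X.Nsq
  have h3 := h.curvDet_pos
  have h4 := sq_abs X.Nbar
  unfold curvDet at *
  have h5 : √X.Nsq ≤ |X.Nbar| := by nlinarith
  by_contra! hcon
  nlinarith

lemma mul_sq_v_le_helicity {c : ℝ} (h : c ≤ |X.Nbar| - √X.Nsq) :
    c * (X.v.re ^ 2 + X.v.im ^ 2) ≤ |X.helicity| := by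
  have h1 := Real.sq_sqrt X.Nsq_nonneg
  have hs : 0 ≤ X.v.re ^ 2 + X.v.im ^ 2 := by positivity
  have h2 := quadratic_le (m := X.Nx.re) (n := X.Nx.im) (d := X.v.re) (e := X.v.im)
    (Real.sqrt_nonneg X.Nsq) (by rw [h1, Nsq])
  have h3 := quadratic_le (m := -X.Nx.re) (n := -X.Nx.im) (d := X.v.re) (e := X.v.im)
    (Real.sqrt_nonneg X.Nsq) (by rw [h1, Nsq]; nlinarith)
  have h4 := mul_le_mul_of_nonneg_right h hs
  unfold helicity
  rcases le_total 0 X.Nbar with h' | h'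
  · rw [abs_of_nonneg h'] at h4
    refine le_trans ?_ (le_abs_self _)
    linarith
  · rw [abs_of_nonpos h'] at h4
    refine le_trans ?_ (neg_le_abs _)
    linarith

/-- The constraint reads (γΩ/G₊)𝐯 = -i(Σ₁N̄ + Σ₁^*N_×), and the right side has modulus at least
(|N̄| - |N_×|)|Σ₁|. -/
lemma mul_sq_S1_le {c : ℝ} (hc0 : 0 ≤ c) (h : c ≤ |X.Nbar| - √X.Nsq) (hc : X.Constraints γ) :
    c ^ 2 * (X.S1.re ^ 2 + X.S1.im ^ 2) ≤ X.om γ ^ 2 * (X.v.re ^ 2 + X.v.im ^ 2) := by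
  have hm : 0 = Complex.I * X.S1 * X.Nbar + Complex.I * star X.S1 * X.Nx
      + ((X.om γ : ℝ) : ℂ) * X.v := hc.momentum_two
  generalize X.om γ = w at *
  have hre := congrArg Complex.re hm
  have him := congrArg Complex.im hm
  simp at hre him
  have h1 := Real.sq_sqrt X.Nsq_nonneg
  have hs : 0 ≤ X.S1.re ^ 2 + X.S1.im ^ 2 := by positivity
  have hr := Real.sqrt_nonneg X.Nsq
  have h2 := quadratic_le (m := X.Nx.re) (n := X.Nx.im) (d := X.S1.re) (e := X.S1.im)
    hr (by rw [h1, Nsq])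
  have h3 := quadratic_le (m := -X.Nx.re) (n := -X.Nx.im) (d := X.S1.re) (e := X.S1.im)
    hr (by rw [h1, Nsq]; nlinarith)
  have hQ : -(|X.Nbar| * √X.Nsq * (X.S1.re ^ 2 + X.S1.im ^ 2)) ≤ X.Nbar * X.curvS1 := by
    unfold curvS1
    rcases le_total 0 X.Nbar with h' | h'
    · rw [abs_of_nonneg h']
      nlinarith
    · rw [abs_of_nonpos h']
      nlinarith
  have e1 : w * X.v.re = X.S1.im * X.Nbar + X.S1.re * X.Nx.im - X.S1.im * X.Nx.re := by linarith
  have e2 : w * X.v.im = -(X.S1.re * X.Nbar + X.S1.re * X.Nx.re + X.S1.im * X.Nx.im) := by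
    linarith
  have e3 : w ^ 2 * (X.v.re ^ 2 + X.v.im ^ 2) = (|X.Nbar| ^ 2 + √X.Nsq ^ 2)
      * (X.S1.re ^ 2 + X.S1.im ^ 2) + 2 * (X.Nbar * X.curvS1) := by
    rw [sq_abs, h1]
    have : w ^ 2 * (X.v.re ^ 2 + X.v.im ^ 2) = (w * X.v.re) ^ 2 + (w * X.v.im) ^ 2 := by ring
    rw [this, e1, e2]
    unfold Nsq curvS1
    ring
  have h4 : c ^ 2 ≤ (|X.Nbar| - √X.Nsq) ^ 2 := pow_le_pow_left₀ hc0 h 2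
  have h5 := mul_le_mul_of_nonneg_right h4 hs
  rw [e3]
  nlinarith

/-- Only the component `Σ₊` of the shear contributes to `-Σ_ab v^a v^b` at leading order if `𝐯`
and `Σ₁` are small. -/
lemma neg_tiltShear_le_of_small (h : X.Admissible) (hc : X.Constraints γ) :
    -X.tiltShear ≤ 2 * X.Sp * X.Vsq + 8 * (X.v.re ^ 2 + X.v.im ^ 2)
      + 2 * (X.S1.re ^ 2 + X.S1.im ^ 2) := by
  have hF := hc.friedmann_eq
  rw [shearSq_eq] at hF
  have hO := h.Om_pos
  have hNs := X.Nsq_nonneg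
  have h3 : √3 ≤ 2 := by rw [Real.sqrt_le_left (by norm_num)]; norm_num
  have h30 : 0 ≤ √3 := Real.sqrt_nonneg 3
  have hSp : X.Sp ^ 2 ≤ 1 := by
    nlinarith [sq_nonneg X.Sx.re, sq_nonneg X.Sx.im, sq_nonneg X.S1.re, sq_nonneg X.S1.im]
  have hSx : X.Sx.re ^ 2 + X.Sx.im ^ 2 ≤ 1 ^ 2 := by
    nlinarith [sq_nonneg X.Sp, sq_nonneg X.S1.re, sq_nonneg X.S1.im]
  have hSp' : -1 ≤ X.Sp := by nlinarith
  have hSp'' : X.Sp ≤ 1 := by nlinarith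
  have hs : 0 ≤ X.v.re ^ 2 + X.v.im ^ 2 := by positivity
  have hs1 : 0 ≤ X.S1.re ^ 2 + X.S1.im ^ 2 := by positivity
  have hQ := quadratic_le (m := -X.Sx.re) (n := -X.Sx.im) (d := X.v.re) (e := X.v.im)
    zero_le_one (by nlinarith)
  have hv1 : X.v1 ^ 2 ≤ 1 := by
    have := h.Vsq_lt_one
    unfold Vsq at this
    linarith
  have hP : -(2 * X.v1 * (X.S1.re * X.v.re + X.S1.im * X.v.im))
      ≤ (X.v.re ^ 2 + X.v.im ^ 2) + (X.S1.re ^ 2 + X.S1.im ^ 2) := by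
    nlinarith [sq_nonneg (X.v.re + X.v1 * X.S1.re), sq_nonneg (X.v.im + X.v1 * X.S1.im),
      mul_le_mul_of_nonneg_right hv1 hs1]
  have a1 := mul_le_mul_of_nonneg_left hQ h30
  have a2 := mul_le_mul_of_nonneg_left hP h30
  have a3 := mul_le_mul_of_nonneg_right h3 hs
  have a4 := mul_le_mul_of_nonneg_right h3 hs1
  have a5 := mul_le_mul_of_nonneg_right hSp' hs
  unfold tiltShear Vsq
  nlinarith

/-- For V² < 1/2 the factor (1 - V²)^(-(2 - γ)) is at most 2² = 4. Contrapositively, `tiltEnergy` ≥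
4ε forces V² ≥ ε. -/
lemma tiltEnergy_le {ε : ℝ} (hε : ε ≤ 1 / 2) (hγ₀ : 0 < γ) (h : X.Vsq < ε) :
    X.tiltEnergy γ ≤ 4 * X.Vsq := by
  have h1 : -Real.log 2 ≤ Real.log (1 - X.Vsq) := by
    rw [← Real.log_inv]
    exact Real.log_le_log (by norm_num) (by linarith)
  have h3 : Real.log (1 - X.Vsq) ≤ 0 := Real.log_nonpos (by linarith)
    (by linarith [X.Vsq_nonneg])
  have h2 : Real.exp (-(2 - γ) * Real.log (1 - X.Vsq)) ≤ 4 := by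
    rw [← Real.le_log_iff_exp_le (by norm_num), show (4 : ℝ) = 2 ^ 2 by norm_num, Real.log_pow]
    push_cast
    nlinarith
  unfold tiltEnergy
  nlinarith [X.Vsq_nonneg]

end State

/-! ### Decay of the tilt. -/

namespace IsEvolution

variable {γ τ₀ : ℝ} {X : ℝ → State}

lemma tendsto_V_of_tiltEnergy (hγ₁ : γ < 2) (hA : ∀ τ, τ₀ ≤ τ → (X τ).Admissible)
    (h : ∀ ε > 0, ∀ᶠ τ in Filter.atTop, (X τ).tiltEnergy γ ≤ ε) :
    Filter.Tendsto (fun τ => (X τ).V) Filter.atTop (nhds 0) := by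
  have h1 : Filter.Tendsto (fun τ => (X τ).Vsq) Filter.atTop (nhds 0) := by
    rw [Metric.tendsto_nhds]
    intro ε hε
    filter_upwards [h (ε / 2) (by positivity), Filter.eventually_ge_atTop τ₀] with τ h1 h2
    rw [Real.dist_eq, sub_zero, abs_of_nonneg (X τ).Vsq_nonneg]
    linarith [State.Vsq_le_tiltEnergy hγ₁ (hA τ h2)]
  have h2 := (Real.continuous_sqrt.tendsto 0).comp h1
  rw [Real.sqrt_zero] at h2
  refine h2.congr fun τ => ?_
  simp only [Function.comp]
  rw [← State.V_sq]
  exact Real.sqrt_sq (Real.sqrt_nonneg _)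

lemma tendsto_V_of_le_two_thirds (hX : IsEvolution γ τ₀ X) (hγ₀ : 0 < γ) (hγ : γ ≤ 2 / 3)
    (hA : ∀ τ, τ₀ ≤ τ → (X τ).Admissible) :
    Filter.Tendsto (fun τ => (X τ).V) Filter.atTop (nhds 0) := by
  have hγ₂ : γ < 2 := by linarith
  set F : ℝ → ℝ := fun τ => (X τ).tiltEnergy γ
    * Real.exp (2 * τ - 1 / 2 * (X τ).logDensity γ) with hF
  have hanti : AntitoneOn F (Set.Ici τ₀) := by
    refine antitoneOn_Ici_of_hasDeriv (fun t ht =>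
      (hX.hasDeriv_tiltEnergy hγ₂ ht (hA t ht)).mul
        ((((hasDerivAt_id t).const_mul 2).hasDerivWithinAt.sub
          ((hX.hasDeriv_logDensity hγ₀ hγ₂ ht (hA t ht)).const_mul (1 / 2))).exp)) ?_
    intro t ht
    have h := hA t ht
    have hz := State.two_q_sub hγ₀ h (hX.constraints t ht)
    have hω := State.om_nonneg hγ₀ h
    have hV := (X t).Vsq_nonneg
    have hS := (X t).shearSq_nonneg
    have hN := (X t).Nsq_nonneg
    have hQ := (X t).neg_tiltShear_le
    have hz' : 4 * (X t).shearSq ≤ 2 * (X t).q γ - (3 * γ - 2) := by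
      rw [hz]
      have : 0 ≤ (4 - 3 * γ) * (X t).Vsq * (X t).om γ :=
        mul_nonneg (mul_nonneg (by linarith) hV) hω
      nlinarith
    unfold State.tiltEnergy
    set e := Real.exp (-(2 - γ) * Real.log (1 - (X t).Vsq)) with he
    have he0 : 0 < e := Real.exp_pos _
    -- The Σ² terms cancel, and the remaining coefficient of V² is 2(3γ - 4) + 2 + 2 = 6γ - 4 ≤ 0.
    have key : 2 * ((3 * γ - 4) * (X t).Vsq - (X t).tiltShear)
        + (X t).Vsq * (2 * 1 - 1 / 2 * (2 * (X t).q γ - (3 * γ - 2))) ≤ 0 := by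
      nlinarith
    have := mul_nonpos_of_nonneg_of_nonpos (mul_nonneg he0.le
      (Real.exp_pos (2 * t - 1 / 2 * (X t).logDensity γ)).le) key
    simp only [id, Pi.sub_apply]
    linarith
  set B := -Real.log (min 1 γ)
  refine tendsto_V_of_tiltEnergy hγ₂ hA fun ε hε => ?_
  have ht := tendsto_const_mul_exp (F τ₀) (1 / 2 * B) (c := 2) two_pos
  filter_upwards [ht.eventually_le_const hε, Filter.eventually_ge_atTop τ₀] with τ h1 h2
  refine le_trans ?_ h1
  have h3 : F τ ≤ F τ₀ := hanti (Set.mem_Ici.2 le_rfl) h2 h2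
  have h4 := State.logDensity_le hγ₀ hγ₂ (hA τ h2) (hX.constraints τ h2)
  have hE0 : ∀ t, 0 ≤ (X t).tiltEnergy γ := fun t =>
    mul_nonneg (X t).Vsq_nonneg (Real.exp_pos _).le
  have hF0 : 0 ≤ F τ₀ := mul_nonneg (hE0 _) (Real.exp_pos _).le
  calc (X τ).tiltEnergy γ = F τ * Real.exp (1 / 2 * (X τ).logDensity γ - 2 * τ) := by
        rw [hF]; simp only
        rw [mul_assoc, ← Real.exp_add]
        simp
    _ ≤ F τ₀ * Real.exp (1 / 2 * B - 2 * τ) := by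
        refine mul_le_mul h3 (Real.exp_le_exp.2 (by linarith)) (Real.exp_pos _).le hF0

/-- The helicity decays exponentially. -/
lemma exists_helicity_bound (hX : IsEvolution γ τ₀ X) (hγ₀ : 0 < γ) (hγ₁ : γ < 2)
    (hA : ∀ τ, τ₀ ≤ τ → (X τ).Admissible) :
    ∃ C, 0 ≤ C ∧ ∀ τ, τ₀ ≤ τ →
      |(X τ).helicity| ≤ C * Real.exp (-(9 - 15 / 2 * γ) * τ) := by
  -- An exact integrating factor: q is half the derivative of `logDensity` plus (3γ - 2)/2, and T is
  -- 3γ - 4 plus (2 - γ)/2 times the derivative of log(1 - V²). The constants sum to (3γ - 2)/2 +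
  -- 2(3γ - 4) = 15γ/2 - 9.
  set w : ℝ → ℝ := fun τ => -(2 - γ) * Real.log (1 - (X τ).Vsq) - 1 / 2 * (X τ).logDensity γ
    + (9 - 15 / 2 * γ) * τ with hw
  have hd : ∀ t, τ₀ ≤ t → HasDerivWithinAt (fun τ => (X τ).helicity * Real.exp (w τ)) 0
      (Set.Ici τ₀) t := by
    intro t ht
    have h := hA t ht
    have h2 := (State.Gm_pos hγ₁ h.Vsq_lt_one.le).ne'
    have e : (X t).T γ = (3 * γ - 4) + (2 - γ) / 2
        * (-(2 * ((3 * γ - 4) * (X t).Vsq - (X t).tiltShear) / (1 - (γ - 1) * (X t).Vsq))) := by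
      rw [State.T_eq]
      generalize hd : 1 - (γ - 1) * (X t).Vsq = d at *
      field_simp
      rw [← hd]
      ring
    refine ((hX.hasDeriv_helicity ht).mul
      ((((hX.hasDeriv_log_one_sub_Vsq hγ₁ ht h).const_mul (-(2 - γ))).sub
        ((hX.hasDeriv_logDensity hγ₀ hγ₁ ht h).const_mul (1 / 2))).add
        ((hasDerivAt_id t).const_mul (9 - 15 / 2 * γ)).hasDerivWithinAt).exp).congr_deriv ?_
    rw [e]
    generalize 2 * ((3 * γ - 4) * (X t).Vsq - (X t).tiltShear) / (1 - (γ - 1) * (X t).Vsq) = d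
    simp only [id, Pi.add_apply, Pi.sub_apply]
    ring
  have hmono := monotoneOn_Ici_of_hasDeriv hd (fun _ _ => le_rfl)
  have hanti := antitoneOn_Ici_of_hasDeriv hd (fun _ _ => le_rfl)
  set B := -Real.log (min 1 γ)
  set J := (X τ₀).helicity * Real.exp (w τ₀) with hJ
  refine ⟨|J| * Real.exp (1 / 2 * B), by positivity, fun τ hτ => ?_⟩
  have hJτ : (X τ).helicity * Real.exp (w τ) = J :=
    le_antisymm (hanti (Set.mem_Ici.2 le_rfl) hτ hτ) (hmono (Set.mem_Ici.2 le_rfl) hτ hτ)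
  have h := hA τ hτ
  have h4 := State.logDensity_le hγ₀ hγ₁ h (hX.constraints τ hτ)
  have h5 : Real.log (1 - (X τ).Vsq) ≤ 0 := Real.log_nonpos (by linarith [h.Vsq_lt_one])
    (by linarith [(X τ).Vsq_nonneg])
  have h6 : (X τ).helicity = J * Real.exp (-w τ) := by
    rw [← hJτ, mul_assoc, ← Real.exp_add]; simp
  rw [h6, abs_mul, Real.abs_exp, mul_assoc, ← Real.exp_add]
  refine mul_le_mul_of_nonneg_left (Real.exp_le_exp.2 ?_) (abs_nonneg _)
  simp only [hw]
  nlinarith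

/-- An upper bound for `Σ₊` that tends to zero. -/
lemma eventually_Sp_le (hX : IsEvolution γ τ₀ X) (hγ₀ : 0 < γ) (hγ₁ : γ < 2)
    (hA : ∀ τ, τ₀ ≤ τ → (X τ).Admissible) {c C : ℝ} (hc : 0 < c) (hC : 0 ≤ C)
    (hS1 : ∀ τ, τ₀ ≤ τ → 3 * ((X τ).S1.re ^ 2 + (X τ).S1.im ^ 2)
      + (X τ).v.re ^ 2 + (X τ).v.im ^ 2 ≤ C * Real.exp (-c * τ)) {ε : ℝ} (hε : 0 < ε) :
    ∀ᶠ τ in Filter.atTop, (X τ).Sp ≤ ε := by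
  have hlim := tendsto_const_mul_exp (C / c) 0 hc
  -- Starting late makes the total remaining forcing, the integral of Ce^(-cτ) from s on, at most
  -- ε/2.
  obtain ⟨s, hs, hsτ⟩ := ((hlim.eventually_le_const (half_pos hε)).and
    (Filter.eventually_ge_atTop τ₀)).exists
  simp only [zero_sub] at hs
  have hr : 0 < 3 - 3 / 2 * γ := by linarith
  -- Subtracting the accumulated forcing η ≥ 0 leaves u' ≤ (q - 2)u, because (q - 2)η ≤ 0.
  set u : ℝ → ℝ := fun τ => (X τ).Sp
    - (C / c * Real.exp (-(c * s)) - C / c * Real.exp (-c * τ)) with hu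
  -- Chosen so that p' = 2 - q; the upper bound on `logDensity` makes p grow at least linearly.
  set p : ℝ → ℝ := fun τ => (3 - 3 / 2 * γ) * τ - 1 / 2 * (X τ).logDensity γ with hp
  have hanti : AntitoneOn (fun τ => u τ * Real.exp (p τ)) (Set.Ici s) := by
    have hsub : Set.Ici s ⊆ Set.Ici τ₀ := Set.Ici_subset_Ici.2 hsτ
    refine antitoneOn_Ici_of_hasDeriv (fun t ht => ((((hX.hasDeriv_Sp (hsτ.trans ht)).sub
      ((((hasDerivAt_id t).const_mul (-c)).exp.const_mul (C / c)).hasDerivWithinAt.const_sub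
        (C / c * Real.exp (-(c * s))))).mul
      ((((hasDerivAt_id t).const_mul (3 - 3 / 2 * γ)).hasDerivWithinAt.sub
        ((hX.hasDeriv_logDensity hγ₀ hγ₁ (hsτ.trans ht) (hA t (hsτ.trans ht))).const_mul
          (1 / 2))).exp)).mono hsub)) ?_
    intro t ht
    have h := hA t (hsτ.trans ht)
    have hcs := hX.constraints t (hsτ.trans ht)
    have hq := State.q_le_two hγ₀ hγ₁ h hcs
    have hω := State.om_nonneg hγ₀ h
    have hω2 := State.om_le_two hγ₀ hγ₁ h hcs
    have hb := hS1 t (hsτ.trans ht)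
    have hη : C / c * Real.exp (-c * t) ≤ C / c * Real.exp (-(c * s)) :=
      mul_le_mul_of_nonneg_left (Real.exp_le_exp.2 (by nlinarith)) (by positivity)
    have hCc : C / c * c = C := div_mul_cancel₀ _ hc.ne'
    have hv : 0 ≤ (X t).v.re ^ 2 + (X t).v.im ^ 2 := by positivity
    have hN := (X t).Nsq_nonneg
    simp only [id, Pi.sub_apply]
    set e := Real.exp (-c * t)
    set E := Real.exp ((3 - 3 / 2 * γ) * t - 1 / 2 * (X t).logDensity γ)
    set η := C / c * Real.exp (-(c * s)) - C / c * e with hηd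
    have hη0 : 0 ≤ η := by linarith
    have e1 : C / c * (e * (-c * 1)) = -(C * e) := by linear_combination (-e) * hCc
    rw [e1]
    have key : ((X t).q γ - 2) * (X t).Sp + 3 * ((X t).S1.re ^ 2 + (X t).S1.im ^ 2)
        - 2 * (X t).Nsq
        + (X t).om γ / 2 * (-2 * (X t).v1 ^ 2 + (X t).v.re ^ 2 + (X t).v.im ^ 2)
        - - -(C * e) + ((X t).Sp - η) * ((3 - 3 / 2 * γ) * 1
          - 1 / 2 * (2 * (X t).q γ - (3 * γ - 2))) ≤ 0 := by
      have k1 := mul_nonneg hω (sq_nonneg (X t).v1)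
      have k2 := mul_le_mul_of_nonneg_right hω2 hv
      have k3 := mul_nonneg (sub_nonneg.2 hq) hη0
      nlinarith
    have := mul_nonpos_of_nonneg_of_nonpos (Real.exp_pos
      ((3 - 3 / 2 * γ) * t - 1 / 2 * (X t).logDensity γ)).le key
    linarith
  set B := -Real.log (min 1 γ)
  have ht := tendsto_const_mul_exp |u s * Real.exp (p s)| (1 / 2 * B) hr
  filter_upwards [ht.eventually_le_const (half_pos hε), Filter.eventually_ge_atTop s]
    with τ h1 h2
  have h3 : u τ * Real.exp (p τ) ≤ u s * Real.exp (p s) := hanti (Set.mem_Ici.2 le_rfl) h2 h2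
  have h4 := State.logDensity_le hγ₀ hγ₁ (hA τ (hsτ.trans h2)) (hX.constraints τ (hsτ.trans h2))
  have h5 : u τ ≤ ε / 2 := by
    refine le_trans ?_ h1
    calc u τ = u τ * Real.exp (p τ) * Real.exp (-p τ) := by
          rw [mul_assoc, ← Real.exp_add]; simp
      _ ≤ |u s * Real.exp (p s)| * Real.exp (-p τ) :=
          mul_le_mul_of_nonneg_right (h3.trans (le_abs_self _)) (Real.exp_pos _).le
      _ ≤ _ := mul_le_mul_of_nonneg_left (Real.exp_le_exp.2 (by simp only [hp]; linarith))
          (abs_nonneg _)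
  have h6 : 0 ≤ C / c * Real.exp (-c * τ) := by positivity
  simp only [hu] at h5
  linarith

lemma tendsto_V_of_two_thirds_lt (hX : IsEvolution γ τ₀ X) (hγ : 2 / 3 < γ) (hγ₁ : γ < 6 / 5)
    (hA : ∀ τ, τ₀ ≤ τ → (X τ).Admissible) :
    Filter.Tendsto (fun τ => (X τ).V) Filter.atTop (nhds 0) := by
  have hγ₀ : 0 < γ := by linarith
  have hγ₂ : γ < 2 := by linarith
  obtain ⟨c, hc, hD⟩ := hX.exists_curvDet_lower_bound hγ hγ₁ hA
  obtain ⟨C, hC, hK⟩ := hX.exists_helicity_bound hγ₀ hγ₂ hA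
  set r := 9 - 15 / 2 * γ with hr
  have hr0 : 0 < r := by linarith
  have hv : ∀ τ, τ₀ ≤ τ → (X τ).v.re ^ 2 + (X τ).v.im ^ 2 ≤ 2 * C / c * Real.exp (-r * τ) := by
    intro τ hτ
    have h1 := State.half_le_sub_sqrt_Nsq hc (hA τ hτ) (hD τ hτ)
    have h2 := (State.mul_sq_v_le_helicity h1).trans (hK τ hτ)
    rw [div_mul_eq_mul_div, le_div_iff₀ hc]
    linarith
  have hS : ∀ τ, τ₀ ≤ τ → (X τ).S1.re ^ 2 + (X τ).S1.im ^ 2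
      ≤ 16 / c ^ 2 * ((X τ).v.re ^ 2 + (X τ).v.im ^ 2) := by
    intro τ hτ
    have h1 := State.half_le_sub_sqrt_Nsq hc (hA τ hτ) (hD τ hτ)
    have h2 := State.mul_sq_S1_le (by positivity) h1 (hX.constraints τ hτ)
    have h3 := State.om_nonneg hγ₀ (hA τ hτ)
    have h4 := State.om_le_two hγ₀ hγ₂ (hA τ hτ) (hX.constraints τ hτ)
    have h5 : (X τ).om γ ^ 2 ≤ 2 ^ 2 := pow_le_pow_left₀ h3 h4 2
    have h6 := mul_le_mul_of_nonneg_right h5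
      (show 0 ≤ (X τ).v.re ^ 2 + (X τ).v.im ^ 2 by positivity)
    rw [div_mul_eq_mul_div, le_div_iff₀ (by positivity)]
    linarith
  set A := (8 + 3 * (16 / c ^ 2)) * (2 * C / c) with hAdef
  have hA0 : 0 ≤ A := by positivity
  have hsmall : ∀ τ, τ₀ ≤ τ → 8 * ((X τ).v.re ^ 2 + (X τ).v.im ^ 2)
      + 3 * ((X τ).S1.re ^ 2 + (X τ).S1.im ^ 2) ≤ A * Real.exp (-r * τ) := by
    intro τ hτ
    have h1 := mul_le_mul_of_nonneg_left (hv τ hτ)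
      (show 0 ≤ 8 + 3 * (16 / c ^ 2) by positivity)
    have h2 := hS τ hτ
    rw [hAdef, mul_assoc]
    linarith
  have hSp := hX.eventually_Sp_le hγ₀ hγ₂ hA hr0 hA0 (fun τ hτ => by
    have := hsmall τ hτ
    linarith [sq_nonneg (X τ).v.re, sq_nonneg (X τ).v.im])
    (ε := (4 - 3 * γ) / 4) (by linarith)
  refine tendsto_V_of_tiltEnergy hγ₂ hA fun ε hε => ?_
  obtain ⟨ε₁, hε₁, hε₂, hε₃⟩ : ∃ ε₁ > 0, ε₁ ≤ 1 / 2 ∧ 4 * ε₁ ≤ ε :=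
    ⟨min (1 / 2) (ε / 4), by positivity, min_le_left _ _,
      by linarith [min_le_right (1 / 2) (ε / 4)]⟩
  have hδ : 0 < (4 - 3 * γ) / 4 * ε₁ := mul_pos (by linarith) hε₁
  have hlim := (tendsto_const_mul_exp A 0 hr0).eventually_le_const hδ
  obtain ⟨s, hs⟩ := Filter.eventually_atTop.1
    (hSp.and (hlim.and (Filter.eventually_ge_atTop τ₀)))
  have hsτ : τ₀ ≤ s := (hs s le_rfl).2.2
  -- While `tiltEnergy` is at least 4ε₁ one has V² ≥ ε₁. Of the damping 4 - 3γ, the bound on Σ₊ then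
  -- uses up a half and the decaying terms a quarter, leaving a quarter, which the factor 2 in the
  -- derivative turns into (4 - 3γ)/2.
  have hmain := eventually_le_of_hasDeriv (a := s) (ε := 4 * ε₁)
    (δ := (4 - 3 * γ) / 2 * ε₁) (mul_pos (by linarith) hε₁)
    (fun t ht => (hX.hasDeriv_tiltEnergy hγ₂ (hsτ.trans ht) (hA t (hsτ.trans ht))).mono
      (Set.Ici_subset_Ici.2 hsτ)) ?_
  · filter_upwards [hmain] with τ h using h.trans hε₃
  intro t ht hE
  obtain ⟨h1, h2, h3⟩ := hs t ht
  have h := hA t h3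
  have hV : ε₁ ≤ (X t).Vsq := by
    by_contra! hcon
    linarith [State.tiltEnergy_le hε₂ hγ₀ hcon]
  have hQ := State.neg_tiltShear_le_of_small h (hX.constraints t h3)
  have h4 := hsmall t h3
  have h5 : A * Real.exp (-r * t) ≤ (4 - 3 * γ) / 4 * ε₁ := by simpa using h2
  have hEV := State.Vsq_le_tiltEnergy hγ₂ h
  have h6 : 2 * ((3 * γ - 4) * (X t).Vsq - (X t).tiltShear)
      ≤ -((4 - 3 * γ) / 2 * (X t).Vsq) := by
    have k1 := mul_le_mul_of_nonneg_right h1 (X t).Vsq_nonneg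
    have k2 : 0 ≤ (X t).S1.re ^ 2 + (X t).S1.im ^ 2 := by positivity
    have k3 := mul_le_mul_of_nonneg_left hV (show 0 ≤ (4 - 3 * γ) / 4 by linarith)
    linarith
  have h7 := mul_le_mul_of_nonneg_left h6
    (Real.exp_pos (-(2 - γ) * Real.log (1 - (X t).Vsq))).le
  unfold State.tiltEnergy at hEV
  have h8 := mul_le_mul_of_nonneg_left (hV.trans hEV) (show 0 ≤ (4 - 3 * γ) / 2 by linarith)
  linarith

end IsEvolution

end BianchiVII0

end

theorem theorem1 (γ : ℝ) (hγ₀ : 0 < γ) (hγ₁ : γ < 6 / 5) (τ₀ : ℝ) (X : ℝ → BianchiVII0.State)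
    (hX : BianchiVII0.IsEvolution γ τ₀ X)
    (hVII : 0 < (X τ₀).Nbar ^ 2 - ‖(X τ₀).Nx‖ ^ 2)
    (hΩ : 0 < (X τ₀).Om) (hV : (X τ₀).V < 1) :
    Filter.Tendsto (fun τ => (X τ).V) Filter.atTop (nhds 0) := by
  have hγ₂ : γ < 2 := by linarith
  have h₀ : (X τ₀).Admissible := by
    refine ⟨?_, hΩ, ?_⟩
    · rw [← BianchiVII0.State.V_sq]
      exact pow_lt_one₀ (Real.sqrt_nonneg _) hV two_ne_zero
    · rwa [BianchiVII0.State.sq_norm_eq] at hVII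
  have hA : ∀ τ, τ₀ ≤ τ → (X τ).Admissible := fun _ hτ => hX.admissible hγ₀ hγ₂ h₀ hτ
  -- The weight 4/(3γ - 2) in `curvLyapunov` is positive only for γ > 2/3.
  rcases le_or_gt γ (2 / 3) with h | h
  · exact hX.tendsto_V_of_le_two_thirds hγ₀ h hA
  · exact hX.tendsto_V_of_two_thirds_lt h hγ₁ hA
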